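/- Let $H$ be a (real or complex) Hilbert space with norm $|\cdot|$ and scalar product $\langle\cdot,\cdot\rangle$, and let $G$ be a Hilbert space over the same field. Assume (A1) $A:D(A)\subset H\to H$ is self-adjoint and nonnegative, has a compact resolvent, and there is $\omega>0$ with $|Au|\ge\omega|u|$ for all $u\in D(A)$. For an integer $k\ge 0$ let $H_k=D(A^{k/2})$ with norm $|u|_k=|A^{k/2}u|$ (so $H_0=H$, $H_2=D(A)$), and for $k\in\mathbb Z$ let $$e_k(u,v)=\tfrac12\big(|A^{k/2}u|^2+|A^{(k-1)/2}v|^2\big).$$ A solution on $[0,T]$ of $w''+Aw=f\in L^2([0,T];H)$ is a function $w\in C([0,T];H_1)\cap C^1([0,T];H)$ that satisfies the equation weakly, i.e. $\langle w'(t),\varphi\rangle=\langle w'(0),\varphi\rangle-\int_0^t\langle w,A\varphi\rangle\,ds+\int_0^t\langle f,\varphi\rangle\,ds$ for all $\varphi\in D(A)$, $t\in[0,T]$; we write $W=(w,w')$. Let $n\ge2$ and let $C_{i\,i-1}$, $2\le i\le n$, be bounded operators on $H$. Assume $(A2)_n$ with $\Pi_i=C_{i\,i-1}$: for every $i\in\{2,\dots,n\}$,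 - $C_{i\,i-1}^*$ maps $H_k$ boundedly into $H_k$ for $k\in\{0,1,\dots,n-i+1\}$; - $|C_{i\,i-1}w|^2\le\|C_{i\,i-1}\|\,\langle C_{i\,i-1}w,w\rangle$ for all $w\in H$; - there is $\alpha_i>0$ with $\alpha_i|C_{i\,i-1}w|^2\le\langle C_{i\,i-1}w,w\rangle$ for all $w\in H$ (in the complex case the real part of the scalar product suffices). Let $\mathbf{B}_n^*$ satisfy $(A4)_n$: $\mathbf{B}_n^*$ is a bounded linear operator from $H_2\times H$ to $G$, and for every $T>0$ there is $D_n(T)>0$ such that all solutions $w$ of $w''+Aw=f\in L^2([0,T];H)$ with $w\in C([0,T];H_2)$ satisfy $$\int_0^T\|\mathbf{B}_n^*(w,w')\|_G^2\,dt\le D_n(T)\Big(e_1(W)(0)+e_1(W)(T)+\int_0^Te_1(W)(t)\,dt+\int_0^T|f|^2\,dt\Big).$$ By density, $(A4)_n$ gives a meaning to $\mathbf{B}_n^*(w,w')\in L^2([0,T];G)$ for every solution $w$ of $w''+Aw=f\in L^2([0,T];H)$: it is the $L^2([0,T];G)$-limit of $\mathbf{B}_n^*(w_j,w_j')$ for solutions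 $w_j\in C([0,T];H_2)$ with sources $f_j$ such that $(w_j,w_j')\to(w,w')$ in $C([0,T];H_1\times H)$ and $f_j\to f$ in $L^2([0,T];H)$. Consider the conditions $(A5)_n$: there is $T_0>0$ such that for every $T>T_0$ there is $R_n(T)>0$ such that all solutions of $w''+Aw=0$ satisfy $\int_0^T\|\mathbf{B}_n^*(w,w')\|_G^2\,dt\ge R_n(T)\,e_1(W)(0)$; $(A3)_n$ (with $\Pi_i=C_{i\,i-1}$): for every $i\in\{2,\dots,n\}$ there is $T_{0,i}>0$ such that for every $T>T_{0,i}$ there is $\gamma_i(T)>0$ such that all solutions of $w''+Aw=0$ satisfy $\int_0^T|C_{i\,i-1}w'|^2\,dt\ge\gamma_i(T)\,e_1(W)(0)$. Assume that $(A5)_n$ fails or that $(A3)_n$ fails. Then there is no $T_n^*>0$ such that for all $T>T_n^*$ the following property holds: $(OBS)_n$: there is $C>0$ such that for all initial data in $H_1^n\times H^n$ the solution of $$u_1''+Au_1=0,\qquad u_i''+Au_i+C_{i\,i-1}u_{i-1}=0\quad(2\le i\le n)$$ satisfies, with $U_i=(u_i,u_i')$, $$C\sum_{i=1}^n e_{1+i-n}(U_i)(0)\le\int_0^T\|\mathbf{B}_n^*U_n\|_G^2\,dt.$$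 -/

import Mathlib

open MeasureTheory Filter Topology Set

noncomputable section

namespace Cascade

variable {𝕜 : Type*} [RCLike 𝕜] {H : Type*} [NormedAddCommGroup H] [InnerProductSpace 𝕜 H]
  [CompleteSpace H]

/-- `A` has a compact resolvent: for some scalar `z` the operator `z - A : D(A) → H` is a bijection
whose inverse is a compact operator on `H`. -/
def HasCompactResolvent (A : H →ₗ.[𝕜] H) : Prop :=
  ∃ (z : 𝕜) (R : H →L[𝕜] H), IsCompactOperator R ∧
    (∀ x : H, ∃ u : A.domain, (u : H) = R x ∧ z • (u : H) - A u = x) ∧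
    (∀ u : A.domain, R (z • (u : H) - A u) = u)

/-- Assumption (A1): `A` is self-adjoint (in particular densely defined), nonnegative,
`|A u| ≥ ω |u|` on `D(A)` for some `ω > 0`, and `A` has a compact resolvent. -/
structure A1 (A : H →ₗ.[𝕜] H) : Prop where
  selfAdjoint : IsSelfAdjoint A
  nonneg : ∀ u : A.domain, 0 ≤ RCLike.re (inner 𝕜 (A u) (u : H))
  coercive : ∃ ω : ℝ, 0 < ω ∧ ∀ u : A.domain, ω * ‖(u : H)‖ ≤ ‖A u‖
  compactResolvent : HasCompactResolvent A

/-- The eigenspace `{u ∈ D(A) : A u = μ u}`. -/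
def eigenspace (A : H →ₗ.[𝕜] H) (μ : ℝ) : Submodule 𝕜 H where
  carrier := {u | ∃ x : A.domain, (x : H) = u ∧ A x = (μ : 𝕜) • u}
  zero_mem' := ⟨0, by simp, by simp⟩
  add_mem' := by
    rintro a b ⟨x, rfl, hx⟩ ⟨y, rfl, hy⟩
    exact ⟨x + y, by simp, by rw [A.map_add, hx, hy, smul_add]⟩
  smul_mem' := by
    rintro c a ⟨x, rfl, hx⟩
    exact ⟨c • x, by simp, by rw [A.map_smul, hx, smul_comm]⟩

/-- The orthogonal projection of `H` onto the eigenspace of `A` for `μ`. (Eigenspaces of a closed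
operator are closed, so the topological closure changes nothing for a self-adjoint `A`.) -/
def eigenProj (A : H →ₗ.[𝕜] H) (μ : ℝ) : H →L[𝕜] H :=
  (eigenspace A μ).topologicalClosure.starProjection

/-- The domain `D(A^s)` of the power `A^s = ∑_μ μ^s P_μ` of a positive self-adjoint operator
with compact resolvent; `μ` runs over the eigenvalues of `A` (`P_μ = 0` for all other `μ`).
The space `H_k` is `powDom A (k / 2)`. -/
def powDom (A : H →ₗ.[𝕜] H) (s : ℝ) : Set H :=
  {u | Summable fun μ : ℝ => ((μ ^ s : ℝ) : 𝕜) • eigenProj A μ u}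

/-- `A^s u = ∑_μ μ^s P_μ u`, for `u ∈ D(A^s)`. The norm of `H_k` is `|u|_k = ‖A^{k/2} u‖`. For
`s ≤ 0` the operator `A^s` is defined on all of `H`. -/
def fracPow (A : H →ₗ.[𝕜] H) (s : ℝ) (u : H) : H :=
  ∑' μ : ℝ, ((μ ^ s : ℝ) : 𝕜) • eigenProj A μ u

/-- The energy of level `k`, `e_k(u, v) = (|A^{k/2} u|² + |A^{(k-1)/2} v|²) / 2`. -/
def energy (A : H →ₗ.[𝕜] H) (k : ℤ) (u v : H) : ℝ :=
  (‖fracPow A ((k : ℝ) / 2) u‖ ^ 2 + ‖fracPow A (((k : ℝ) - 1) / 2) v‖ ^ 2) / 2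

/-- `(w, w')` is a (finite energy) solution on `[0, T]` of `w'' + A w = f ∈ L²([0, T]; H)`:
`(w, w')` is continuous with values in `H_1 × H`, `w'` is the time derivative of `w`, and
`(w')' = - A w + f` holds in integrated weak form, tested against the elements of `D(A)`.
The initial data are `(w 0, w' 0) ∈ H_1 × H`. -/
structure IsSol (A : H →ₗ.[𝕜] H) (T : ℝ) (f w w' : ℝ → H) : Prop where
  source : MemLp f 2 (volume.restrict (Icc 0 T))
  mem : ∀ t ∈ Icc 0 T, w t ∈ powDom A (1 / 2)
  cont : ContinuousOn (fun t => fracPow A (1 / 2) (w t)) (Icc 0 T)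
  cont' : ContinuousOn w' (Icc 0 T)
  deriv : ∀ φ : H, ∀ t ∈ Icc 0 T,
    inner 𝕜 φ (w t) = inner 𝕜 φ (w 0) + ∫ s in (0 : ℝ)..t, inner 𝕜 φ (w' s)
  equation : ∀ φ : A.domain, ∀ t ∈ Icc 0 T,
    inner 𝕜 (φ : H) (w' t) = inner 𝕜 (φ : H) (w' 0)
      - (∫ s in (0 : ℝ)..t, inner 𝕜 (A φ) (w s)) + ∫ s in (0 : ℝ)..t, inner 𝕜 (φ : H) (f s)

/-- A solution that moreover is continuous with values in `H_2 = D(A)`. -/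
def IsStrongSol (A : H →ₗ.[𝕜] H) (T : ℝ) (f : ℝ → H) (w : ℝ → A.domain) (w' : ℝ → H) : Prop :=
  IsSol A T f (fun t => (w t : H)) w' ∧ ContinuousOn (fun t => A (w t)) (Icc 0 T)

/-- `(u_1, …, u_n)` with velocities `(v_1, …, v_n)` is a solution on `[0, T]` of the bi-diagonal
cascade system `u_1'' + A u_1 = 0`, `u_i'' + A u_i + C_{i,i-1} u_{i-1} = 0` for `2 ≤ i ≤ n`, with
initial data in `H_1^n × H^n`. Here `C i` stands for `C_{i,i-1}`; only the indices `1, …, n` of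
`u`, `v` and `2, …, n` of `C` matter. -/
def IsCascadeSol (A : H →ₗ.[𝕜] H) (C : ℕ → H →L[𝕜] H) (n : ℕ) (T : ℝ) (u v : ℕ → ℝ → H) : Prop :=
  IsSol A T (fun _ => 0) (u 1) (v 1) ∧
    ∀ i ∈ Finset.Icc 2 n, IsSol A T (fun t => -C i (u (i - 1) t)) (u i) (v i)

/-- `L ∈ 𝓛(H_k)`: `L` maps `H_k` into itself and is bounded for the norm of `H_k`. -/
def BoundedOnH (A : H →ₗ.[𝕜] H) (k : ℕ) (L : H →L[𝕜] H) : Prop :=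
  ∃ M : ℝ, ∀ u ∈ powDom A ((k : ℝ) / 2), L u ∈ powDom A ((k : ℝ) / 2) ∧
    ‖fracPow A ((k : ℝ) / 2) (L u)‖ ≤ M * ‖fracPow A ((k : ℝ) / 2) u‖

/-- Assumption (A2)_n on the couplings `C i = C_{i,i-1}` and the operators `P i = Π_i`. -/
def A2 (A : H →ₗ.[𝕜] H) (C P : ℕ → H →L[𝕜] H) (n : ℕ) : Prop :=
  ∀ i ∈ Finset.Icc 2 n,
    (∀ k ∈ Finset.Icc 0 (n - i + 1), BoundedOnH A k (ContinuousLinearMap.adjoint (C i))) ∧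
    (∀ w : H, ‖C i w‖ ^ 2 ≤ ‖C i‖ * RCLike.re (inner 𝕜 (C i w) w)) ∧
    (∃ α : ℝ, 0 < α ∧ ∀ w : H, α * ‖P i w‖ ^ 2 ≤ RCLike.re (inner 𝕜 (C i w) w))

/-- Assumption (A3)_n on the operators `P i = Π_i`. -/
def A3 (A : H →ₗ.[𝕜] H) (P : ℕ → H →L[𝕜] H) (n : ℕ) : Prop :=
  ∀ i ∈ Finset.Icc 2 n, ∃ T₀ : ℝ, 0 < T₀ ∧ ∀ T : ℝ, T₀ < T → ∃ γ : ℝ, 0 < γ ∧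
    ∀ w w' : ℝ → H, IsSol A T (fun _ => 0) w w' →
      γ * energy A 1 (w 0) (w' 0) ≤ ∫ t in (0 : ℝ)..T, ‖P i (w' t)‖ ^ 2

variable {G : Type*} [NormedAddCommGroup G] [InnerProductSpace 𝕜 G]

/-- Assumption (A4)_n on the observation operator `B`: it belongs to `𝓛(H_2 × H; G)` and it is
admissible. Since `B (w, w')` makes sense a priori only for `w` with values in `H_2`, the
admissibility inequality is required for those solutions; it is what allows to
define `B (w, w')` for all solutions, see `IsObservation`. -/
def A4 (A : H →ₗ.[𝕜] H) (B : A.domain × H →ₗ[𝕜] G) : Prop :=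
  (∃ M : ℝ, ∀ (u : A.domain) (v : H), ‖B (u, v)‖ ≤ M * (‖A u‖ + ‖v‖)) ∧
  ∀ T : ℝ, 0 < T → ∃ D : ℝ, 0 < D ∧
    ∀ (f : ℝ → H) (w : ℝ → A.domain) (w' : ℝ → H), IsStrongSol A T f w w' →
      ∫ t in (0 : ℝ)..T, ‖B (w t, w' t)‖ ^ 2 ≤
        D * (energy A 1 (w 0) (w' 0) + energy A 1 (w T) (w' T)
          + (∫ t in (0 : ℝ)..T, energy A 1 (w t) (w' t)) + ∫ t in (0 : ℝ)..T, ‖f t‖ ^ 2)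

/-- `y ∈ L²([0, T]; G)` is the observation `B (w, w')` of the finite energy solution `(w, w')` of
`w'' + A w = f`, in the sense of extension by density: it is the `L²` limit of `B (w_j, w_j')`
for solutions `(w_j, w_j')` with values in `H_2 × H`, with sources `f_j`, such that
`(w_j, w_j') → (w, w')` in `C([0, T]; H_1 × H)` and `f_j → f` in `L²([0, T]; H)`. Under (A4)_n every
finite energy solution has exactly one observation (up to null sets), and it is `B (w, w')` itself
if `w` is continuous with values in `H_2`. -/
def IsObservation (A : H →ₗ.[𝕜] H) (B : A.domain × H →ₗ[𝕜] G) (T : ℝ) (f w w' : ℝ → H)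
    (y : ℝ → G) : Prop :=
  MemLp y 2 (volume.restrict (Icc 0 T)) ∧
  ∃ (fs : ℕ → ℝ → H) (ws : ℕ → ℝ → A.domain) (ws' : ℕ → ℝ → H),
    (∀ j, IsStrongSol A T (fs j) (ws j) (ws' j)) ∧
    TendstoUniformlyOn (fun j t => fracPow A (1 / 2) (ws j t : H)) (fun t => fracPow A (1 / 2) (w t))
      atTop (Icc 0 T) ∧
    TendstoUniformlyOn ws' w' atTop (Icc 0 T) ∧
    Tendsto (fun j => eLpNorm (fun t => fs j t - f t) 2 (volume.restrict (Icc 0 T)))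
      atTop (𝓝 0) ∧
    Tendsto (fun j => eLpNorm (fun t => B (ws j t, ws' j t) - y t) 2
      (volume.restrict (Icc 0 T))) atTop (𝓝 0)

/-- Assumption (A5)_n: observability of the single equation `w'' + A w = 0` through `B`. -/
def A5 (A : H →ₗ.[𝕜] H) (B : A.domain × H →ₗ[𝕜] G) : Prop :=
  ∃ T₀ : ℝ, 0 < T₀ ∧ ∀ T : ℝ, T₀ < T → ∃ R : ℝ, 0 < R ∧
    ∀ (w w' : ℝ → H) (y : ℝ → G), IsSol A T (fun _ => 0) w w' →
      IsObservation A B T (fun _ => 0) w w' y →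
      R * energy A 1 (w 0) (w' 0) ≤ ∫ t in (0 : ℝ)..T, ‖y t‖ ^ 2

/-- The observability inequality (OBS)_n at time `T`, for all solutions of the cascade system with
initial data in `H_1^n × H^n`; `y` is the observation `B (u_n, u_n')` of the last component. -/
def OBS (A : H →ₗ.[𝕜] H) (C : ℕ → H →L[𝕜] H) (n : ℕ) (B : A.domain × H →ₗ[𝕜] G) (T : ℝ) : Prop :=
  ∃ c : ℝ, 0 < c ∧ ∀ (u v : ℕ → ℝ → H) (y : ℝ → G), IsCascadeSol A C n T u v →
    IsObservation A B T (fun t => -C n (u (n - 1) t)) (u n) (v n) y →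
    c * ∑ i ∈ Finset.Icc 1 n, energy A (1 + (i : ℤ) - (n : ℤ)) (u i 0) (v i 0) ≤
      ∫ t in (0 : ℝ)..T, ‖y t‖ ^ 2

end Cascade

end

/-!
Applied to cascades whose only nonzero component is the last one, `OBS` is exactly `A5`.

For `A3`, fix `i`, put `m = i - 1`, let `w` be a smooth free solution, and drive a chain of
equations from rest by `V 0 = w`, `V (k + 1)'' + A V (k + 1) = -C (m + k + 1) (V k)'`, where each
source is switched on smoothly in time. After the switching, the derivatives of order `n - j` of
`V (j - m)`, for `m ≤ j ≤ n`, solve the cascade system, with zero in the positions below `m`. A time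
derivative lowers the level of the energy by one, so the weighted energy of component `m` is
`e_1` of `w`, whereas the last component is `V (n - m)` itself, with no derivative. Since it starts
from rest, energy estimates along the chain and the admissibility of the observation bound the
right-hand side of `OBS` by a multiple of `∫ |C i w'|²`. Truncating the spectral expansion extends
the resulting inequality from smooth to arbitrary free solutions.
-/

noncomputable section

namespace Cascade

variable {𝕜 : Type*} [RCLike 𝕜] {H : Type*} [NormedAddCommGroup H] [InnerProductSpace 𝕜 H]
  [CompleteSpace H] {A : H →ₗ.[𝕜] H}

namespace A1

theorem inner_map_left (hA : A1 A) (u v : A.domain) :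
    inner 𝕜 (A u) (v : H) = inner 𝕜 (u : H) (A v) := by
  have h := LinearPMap.adjoint_isFormalAdjoint hA.selfAdjoint.dense_domain
  rw [LinearPMap.isSelfAdjoint_def.1 hA.selfAdjoint] at h
  exact h u v

theorem eq_zero_of_map_eq_zero (hA : A1 A) {u : A.domain} (hu : A u = 0) : u = 0 := by
  obtain ⟨ω, hω, hc⟩ := hA.coercive
  have h := hc u
  rw [hu, norm_zero] at h
  exact Subtype.ext (norm_le_zero_iff.1 (nonpos_of_mul_nonpos_right h hω))

theorem eq_zero_of_orthogonal_range (hA : A1 A) {y : H}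
    (hy : ∀ u : A.domain, inner 𝕜 y (A u) = 0) : y = 0 := by
  have hmem : y ∈ A.adjoint.domain :=
    LinearPMap.mem_adjoint_domain_of_exists y ⟨0, fun x => by rw [inner_zero_left, hy x]⟩
  rw [LinearPMap.isSelfAdjoint_def.1 hA.selfAdjoint] at hmem
  have h0 : A ⟨y, hmem⟩ = 0 := hA.selfAdjoint.dense_domain.eq_zero_of_inner_left 𝕜 fun v hv =>
    (hA.inner_map_left ⟨y, hmem⟩ ⟨v, hv⟩).trans (hy _)
  exact congrArg Subtype.val (hA.eq_zero_of_map_eq_zero h0)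

theorem completeSpace_graph (hA : A1 A) : CompleteSpace A.graph :=
  have : IsClosed (A.graph : Set (H × H)) := hA.selfAdjoint.isClosed
  this.completeSpace_coe

theorem exists_antilipschitzWith_graph_snd (hA : A1 A) :
    ∃ c, AntilipschitzWith c ((ContinuousLinearMap.snd 𝕜 H H).comp A.graph.subtypeL) := by
  obtain ⟨ω, hω, hc⟩ := hA.coercive
  refine ⟨(max ω⁻¹ 1).toNNReal, ContinuousLinearMap.antilipschitz_of_bound _ ?_⟩
  rintro ⟨p, hp⟩
  obtain ⟨u, rfl⟩ := A.mem_graph_iff'.1 hp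
  rw [Real.coe_toNNReal _ (by positivity)]
  change max ‖(u : H)‖ ‖A u‖ ≤ max ω⁻¹ 1 * ‖A u‖
  rw [max_mul_of_nonneg _ _ (norm_nonneg _), one_mul]
  exact max_le_max_right _ ((le_inv_mul_iff₀ hω).2 (hc u))

theorem denseRange_graph_snd (hA : A1 A) :
    DenseRange ((ContinuousLinearMap.snd 𝕜 H H).comp A.graph.subtypeL) := by
  let S : A.graph →L[𝕜] H := (ContinuousLinearMap.snd 𝕜 H H).comp A.graph.subtypeL
  have hS : S.rangeᗮ = ⊥ := (Submodule.eq_bot_iff _).2 fun y hy =>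
    hA.eq_zero_of_orthogonal_range fun u =>
      Submodule.inner_left_of_mem_orthogonal (S.mem_range_self ⟨_, A.mem_graph u⟩) hy
  exact Submodule.dense_iff_topologicalClosure_eq_top.2
    (Submodule.topologicalClosure_eq_top_iff.2 hS)

theorem surjective_graph_snd (hA : A1 A) :
    Function.Surjective ((ContinuousLinearMap.snd 𝕜 H H).comp A.graph.subtypeL) := by
  have := hA.completeSpace_graph
  obtain ⟨c, hc⟩ := hA.exists_antilipschitzWith_graph_snd
  rw [← Set.range_eq_univ, ← hA.denseRange_graph_snd.closure_range]
  exact (hc.isClosed_range (ContinuousLinearMap.uniformContinuous _)).closure_eq.symm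

/-- The graph of `A`, identified with `H` through its second component: `A` is a bijection of
`D(A)` onto `H`. -/
def graphEquiv (hA : A1 A) : A.graph ≃L[𝕜] H :=
  haveI := hA.completeSpace_graph
  ContinuousLinearEquiv.ofBijective ((ContinuousLinearMap.snd 𝕜 H H).comp A.graph.subtypeL)
    (LinearMap.ker_eq_bot.2 hA.exists_antilipschitzWith_graph_snd.choose_spec.injective)
    (LinearMap.range_eq_top.2 hA.surjective_graph_snd)

/-- The bounded inverse of `A`. -/
def inv (hA : A1 A) : H →L[𝕜] H :=
  (ContinuousLinearMap.fst 𝕜 H H).comp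
    (A.graph.subtypeL.comp (hA.graphEquiv.symm : H →L[𝕜] A.graph))

theorem inv_mem_graph (hA : A1 A) (x : H) : (hA.inv x, x) ∈ A.graph := by
  have h : (hA.graphEquiv.symm x : H × H) = (hA.inv x, x) :=
    Prod.ext rfl (hA.graphEquiv.apply_symm_apply x)
  exact h ▸ (hA.graphEquiv.symm x).2

theorem inv_mem (hA : A1 A) (x : H) : hA.inv x ∈ A.domain :=
  LinearPMap.mem_domain_of_mem_graph (hA.inv_mem_graph x)

theorem map_inv (hA : A1 A) (x : H) : A ⟨hA.inv x, hA.inv_mem x⟩ = x :=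
  ((LinearPMap.image_iff (hA.inv_mem x)).2 (hA.inv_mem_graph x)).symm

theorem inv_map (hA : A1 A) (u : A.domain) : hA.inv (A u) = u := by
  have h : A (⟨hA.inv (A u), hA.inv_mem _⟩ - u) = 0 := by rw [A.map_sub, hA.map_inv, sub_self]
  exact congrArg Subtype.val (sub_eq_zero.1 (hA.eq_zero_of_map_eq_zero h))

theorem isCompactOperator_inv (hA : A1 A) : IsCompactOperator hA.inv := by
  obtain ⟨z, R, hR, -, hRz⟩ := hA.compactResolvent
  have resolvent_identity : hA.inv = R.comp (z • hA.inv - 1) := by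
    ext x
    simpa [hA.map_inv] using (hRz ⟨hA.inv x, hA.inv_mem x⟩).symm
  rw [resolvent_identity]
  exact hR.comp_clm _

theorem inner_inv_left (hA : A1 A) (x y : H) :
    inner 𝕜 (hA.inv x) y = inner 𝕜 x (hA.inv y) := by
  have := hA.inner_map_left ⟨_, hA.inv_mem x⟩ ⟨_, hA.inv_mem y⟩
  rw [hA.map_inv, hA.map_inv] at this
  exact this.symm

theorem mem_eigenspace_iff (hA : A1 A) {μ : ℝ} {u : H} :
    u ∈ eigenspace A μ ↔ u = (μ : 𝕜) • hA.inv u := by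
  constructor
  · rintro ⟨x, rfl, hx⟩
    rw [← map_smul, ← hx, hA.inv_map]
  · intro h
    rw [← map_smul] at h
    exact ⟨⟨hA.inv ((μ : 𝕜) • u), hA.inv_mem _⟩, h.symm, hA.map_inv _⟩

theorem isClosed_eigenspace (hA : A1 A) (μ : ℝ) : IsClosed (eigenspace A μ : Set H) := by
  have : (eigenspace A μ : Set H) = {u | u = (μ : 𝕜) • hA.inv u} :=
    Set.ext fun u => hA.mem_eigenspace_iff
  rw [this]
  exact isClosed_eq continuous_id (by fun_prop)

theorem inner_eq_zero_of_mem_eigenspace (hA : A1 A) {μ ν : ℝ} (h : μ ≠ ν) {u v : H}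
    (hu : u ∈ eigenspace A μ) (hv : v ∈ eigenspace A ν) : inner 𝕜 u v = 0 := by
  obtain ⟨x, rfl, hx⟩ := hu
  obtain ⟨y, rfl, hy⟩ := hv
  have hxy := hA.inner_map_left x y
  rw [hx, hy, inner_smul_left, inner_smul_right, RCLike.conj_ofReal] at hxy
  by_contra hne
  exact h (by exact_mod_cast mul_right_cancel₀ hne hxy)

theorem exists_pos_le_eigenvalue (hA : A1 A) :
    ∃ ω : ℝ, 0 < ω ∧ ∀ μ : ℝ, ∀ u ∈ eigenspace A μ, u ≠ 0 → ω ≤ μ := by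
  obtain ⟨ω, hω, hc⟩ := hA.coercive
  refine ⟨ω, hω, ?_⟩
  rintro μ u ⟨x, rfl, hx⟩ hu
  have hpos : 0 < ‖(x : H)‖ := norm_pos_iff.2 hu
  have hinner := hA.nonneg x
  rw [hx, inner_smul_left, RCLike.conj_ofReal, RCLike.re_ofReal_mul, inner_self_eq_norm_sq]
    at hinner
  have hμ : 0 ≤ μ := nonneg_of_mul_nonneg_left hinner (by positivity)
  have hnorm := hc x
  rw [hx, norm_smul, RCLike.norm_ofReal, abs_of_nonneg hμ] at hnorm
  exact le_of_mul_le_mul_right hnorm hpos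

theorem orthogonalFamily_eigenspace (hA : A1 A) : OrthogonalFamily 𝕜
    (fun μ : ℝ => eigenspace A μ) fun μ => (eigenspace A μ).subtypeₗᵢ :=
  fun _ _ h u v => hA.inner_eq_zero_of_mem_eigenspace h u.2 v.2

theorem eq_zero_of_inv_eq_zero (hA : A1 A) {x : H} (hx : hA.inv x = 0) : x = 0 := by
  have h0 : (⟨hA.inv x, hA.inv_mem x⟩ : A.domain) = 0 := Subtype.ext hx
  rw [← hA.map_inv x, h0, A.map_zero]

theorem inv_eigenspace_le (hA : A1 A) (κ : 𝕜) :
    Module.End.eigenspace (hA.inv : H →ₗ[𝕜] H) κ ≤ ⨆ μ : ℝ, eigenspace A μ := by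
  intro u hu
  rcases eq_or_ne u 0 with rfl | hu0
  · exact zero_mem _
  have hinv : hA.inv u = κ • u := Module.End.mem_eigenspace_iff.1 hu
  have hκ : ((RCLike.re κ : ℝ) : 𝕜) = κ :=
    RCLike.conj_eq_iff_re.1 <| LinearMap.IsSymmetric.conj_eigenvalue_eq_self
      (T := (hA.inv : H →ₗ[𝕜] H)) (fun x y => hA.inner_inv_left x y)
      (Module.End.hasEigenvalue_of_hasEigenvector ⟨hu, hu0⟩)
  have hκ0 : κ ≠ 0 := by
    rintro rfl
    exact hu0 (hA.eq_zero_of_inv_eq_zero (hinv.trans (zero_smul _ _)))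
  refine Submodule.mem_iSup_of_mem (RCLike.re κ)⁻¹ (hA.mem_eigenspace_iff.2 ?_)
  rw [hinv, smul_smul, RCLike.ofReal_inv, hκ, inv_mul_cancel₀ hκ0, one_smul]

theorem iSup_eigenspace_orthogonal (hA : A1 A) : (⨆ μ : ℝ, eigenspace A μ)ᗮ = ⊥ := by
  rw [eq_bot_iff, ← ContinuousLinearMap.orthogonalComplement_iSup_eigenspaces_eq_bot
    hA.isCompactOperator_inv fun x y => hA.inner_inv_left x y]
  exact Submodule.orthogonal_le (iSup_le hA.inv_eigenspace_le)

end A1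

theorem eigenProj_of_mem {μ : ℝ} {x : H} (hx : x ∈ eigenspace A μ) : eigenProj A μ x = x :=
  Submodule.starProjection_eq_self_iff.2 ((eigenspace A μ).le_topologicalClosure hx)

theorem inner_eigenProj_left (μ : ℝ) (x y : H) :
    inner 𝕜 (eigenProj A μ x) y = inner 𝕜 x (eigenProj A μ y) :=
  Submodule.inner_starProjection_left_eq_right _ _ _

theorem norm_eigenProj_sq (μ : ℝ) (x : H) :
    ‖eigenProj A μ x‖ ^ 2 = RCLike.re (inner 𝕜 x (eigenProj A μ x)) := by
  have h : eigenProj A μ (eigenProj A μ x) = eigenProj A μ x :=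
    Submodule.starProjection_eq_self_iff.2 (Submodule.starProjection_apply_mem _ _)
  rw [← inner_self_eq_norm_sq (𝕜 := 𝕜), inner_eigenProj_left, h]

namespace A1

theorem eigenProj_mem (hA : A1 A) (μ : ℝ) (x : H) : eigenProj A μ x ∈ eigenspace A μ := by
  have h : eigenProj A μ x ∈ (eigenspace A μ).topologicalClosure :=
    Submodule.starProjection_apply_mem _ _
  rwa [(hA.isClosed_eigenspace μ).submodule_topologicalClosure_eq] at h

theorem eigenProj_eigenProj (hA : A1 A) (μ : ℝ) (x : H) :
    eigenProj A μ (eigenProj A μ x) = eigenProj A μ x :=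
  eigenProj_of_mem (hA.eigenProj_mem μ x)

theorem eigenProj_of_mem_ne (hA : A1 A) {μ ν : ℝ} (h : μ ≠ ν) {x : H}
    (hx : x ∈ eigenspace A ν) : eigenProj A μ x = 0 := by
  rw [← inner_self_eq_zero (𝕜 := 𝕜), inner_eigenProj_left, hA.eigenProj_eigenProj]
  exact hA.inner_eq_zero_of_mem_eigenspace h.symm hx (hA.eigenProj_mem μ x)

theorem eigenProj_eq_zero_of_nonpos (hA : A1 A) {μ : ℝ} (hμ : μ ≤ 0) (x : H) :
    eigenProj A μ x = 0 := by
  obtain ⟨ω, hω, h⟩ := hA.exists_pos_le_eigenvalue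
  by_contra hc
  linarith [h μ _ (hA.eigenProj_mem μ x) hc]

theorem eigenProj_map (hA : A1 A) (u : A.domain) (μ : ℝ) :
    eigenProj A μ (A u) = (μ : 𝕜) • eigenProj A μ (u : H) := by
  refine ext_inner_left 𝕜 fun y => ?_
  obtain ⟨p, hp, hAp⟩ := hA.eigenProj_mem μ y
  rw [inner_smul_right, ← inner_eigenProj_left, ← inner_eigenProj_left, ← hp, ← hA.inner_map_left,
    hAp, inner_smul_left, RCLike.conj_ofReal, hp]

theorem eigenProj_hasSum (hA : A1 A) {v : ℝ → H} (hv : ∀ ν, v ν ∈ eigenspace A ν) {x : H}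
    (h : HasSum v x) (μ : ℝ) : eigenProj A μ x = v μ := by
  have hsingle := hasSum_single (f := fun ν => eigenProj A μ (v ν)) μ
    fun ν hν => hA.eigenProj_of_mem_ne hν.symm (hv ν)
  rw [eigenProj_of_mem (hv μ)] at hsingle
  exact ((eigenProj A μ).hasSum h).unique hsingle

theorem hasSum_eigenProj (hA : A1 A) (x : H) : HasSum (fun μ => eigenProj A μ x) x := by
  have : ∀ μ : ℝ, CompleteSpace (eigenspace A μ) :=
    fun μ => (hA.isClosed_eigenspace μ).completeSpace_coe
  have hV : IsHilbertSum 𝕜 (fun μ : ℝ => eigenspace A μ) fun μ => (eigenspace A μ).subtypeₗᵢ := by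
    refine IsHilbertSum.mkInternal _ hA.orthogonalFamily_eigenspace ?_
    rw [top_le_iff, Submodule.topologicalClosure_eq_top_iff]
    exact hA.iSup_eigenspace_orthogonal
  have hsum := hV.hasSum_linearIsometryEquiv_symm (hV.linearIsometryEquiv x)
  rw [LinearIsometryEquiv.symm_apply_apply] at hsum
  refine hsum.congr_fun fun μ => ?_
  exact hA.eigenProj_hasSum (fun ν => (hV.linearIsometryEquiv x ν).2) hsum μ

theorem ext_eigenProj (hA : A1 A) {x y : H}
    (h : ∀ μ : ℝ, 0 < μ → eigenProj A μ x = eigenProj A μ y) : x = y := by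
  refine (hA.hasSum_eigenProj x).unique ((hA.hasSum_eigenProj y).congr_fun fun μ => ?_)
  rcases le_or_gt μ 0 with hμ | hμ
  · simp only [hA.eigenProj_eq_zero_of_nonpos hμ]
  · exact h μ hμ

theorem hasSum_norm_eigenProj_sq (hA : A1 A) (x : H) :
    HasSum (fun μ => ‖eigenProj A μ x‖ ^ 2) (‖x‖ ^ 2) := by
  have h := (RCLike.reCLM (K := 𝕜)).hasSum ((innerSL 𝕜 x).hasSum (hA.hasSum_eigenProj x))
  simp only [innerSL_apply_apply, RCLike.reCLM_apply, inner_self_eq_norm_sq] at h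
  simpa only [norm_eigenProj_sq] using h

theorem norm_le_of_eigenProj (hA : A1 A) {x y : H} {c : ℝ} (hc : 0 ≤ c)
    (h : ∀ μ, ‖eigenProj A μ x‖ ≤ c * ‖eigenProj A μ y‖) : ‖x‖ ≤ c * ‖y‖ := by
  have hsq := hasSum_le (fun μ => ?_) (hA.hasSum_norm_eigenProj_sq x)
    ((hA.hasSum_norm_eigenProj_sq y).mul_left (c ^ 2))
  · rw [← mul_pow] at hsq
    exact (sq_le_sq₀ (norm_nonneg _) (by positivity)).1 hsq
  · rw [← mul_pow]
    exact pow_le_pow_left₀ (norm_nonneg _) (h μ) 2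

end A1

/-- `L = m(A)`: the operator `L` acts on the eigenspace for `μ` as multiplication by `m μ`. Only
`μ > 0` matters, since all eigenvalues of an operator satisfying (A1) are positive. -/
def IsMultiplier (A : H →ₗ.[𝕜] H) (m : ℝ → ℝ) (L : H →L[𝕜] H) : Prop :=
  ∀ μ, 0 < μ → ∀ x, eigenProj A μ (L x) = (m μ : 𝕜) • eigenProj A μ x

namespace A1

variable {m : ℝ → ℝ} {M : ℝ}

theorem norm_smul_eigenProj_le (hA : A1 A) (hM : ∀ μ, ∀ u ∈ eigenspace A μ, u ≠ 0 → |m μ| ≤ M)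
    (μ : ℝ) (x : H) : ‖(m μ : 𝕜) • eigenProj A μ x‖ ≤ |M| * ‖eigenProj A μ x‖ := by
  rw [norm_smul, RCLike.norm_ofReal]
  rcases eq_or_ne (eigenProj A μ x) 0 with h | h
  · simp only [h, norm_zero, mul_zero, le_refl]
  · exact mul_le_mul_of_nonneg_right
      ((hM μ _ (hA.eigenProj_mem μ x) h).trans (le_abs_self M)) (norm_nonneg _)

theorem summable_smul_eigenProj (hA : A1 A)
    (hM : ∀ μ, ∀ u ∈ eigenspace A μ, u ≠ 0 → |m μ| ≤ M) (x : H) :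
    Summable fun μ => (m μ : 𝕜) • eigenProj A μ x := by
  have h := hA.orthogonalFamily_eigenspace.summable_iff_norm_sq_summable fun μ =>
    ⟨(m μ : 𝕜) • eigenProj A μ x, Submodule.smul_mem _ _ (hA.eigenProj_mem μ x)⟩
  refine h.2 (Summable.of_nonneg_of_le (fun _ => sq_nonneg _) (fun μ => ?_)
    ((hA.hasSum_norm_eigenProj_sq x).summable.mul_left (|M| ^ 2)))
  rw [← mul_pow]
  exact pow_le_pow_left₀ (norm_nonneg _) (hA.norm_smul_eigenProj_le hM μ x) 2

theorem exists_isMultiplier (hA : A1 A) (hM : ∀ μ, ∀ u ∈ eigenspace A μ, u ≠ 0 → |m μ| ≤ M) :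
    ∃ L, IsMultiplier A m L := by
  have hs := hA.summable_smul_eigenProj hM
  let L₀ : H →ₗ[𝕜] H :=
    { toFun := fun x => ∑' μ, (m μ : 𝕜) • eigenProj A μ x
      map_add' := fun x y => by
        rw [← (hs x).tsum_add (hs y)]
        simp only [map_add, smul_add]
      map_smul' := fun c x => by
        rw [RingHom.id_apply, ← (hs x).tsum_const_smul c]
        simp only [map_smul]
        exact tsum_congr fun μ => smul_comm _ _ _ }
  have hL (μ x) : eigenProj A μ (L₀ x) = (m μ : 𝕜) • eigenProj A μ x :=
    hA.eigenProj_hasSum (fun ν => Submodule.smul_mem _ _ (hA.eigenProj_mem ν x)) (hs x).hasSum μ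
  refine ⟨L₀.mkContinuous |M| fun x => hA.norm_le_of_eigenProj (abs_nonneg M) fun μ => ?_,
    fun μ _ => hL μ⟩
  rw [hL]
  exact hA.norm_smul_eigenProj_le hM μ x

theorem isMultiplier_inv (hA : A1 A) : IsMultiplier A (fun μ => μ⁻¹) hA.inv := fun μ hμ x => by
  have hμ' : (μ : 𝕜) ≠ 0 := by exact_mod_cast hμ.ne'
  have h := hA.eigenProj_map ⟨hA.inv x, hA.inv_mem x⟩ μ
  rw [hA.map_inv] at h
  rw [h, RCLike.ofReal_inv, inv_smul_smul₀ hμ']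

end A1

namespace IsMultiplier

variable {m m' : ℝ → ℝ} {L L' : H →L[𝕜] H}

theorem norm_le (hA : A1 A) (hL : IsMultiplier A m L) {M : ℝ} (hM0 : 0 ≤ M)
    (hM : ∀ μ, 0 < μ → |m μ| ≤ M) (x : H) : ‖L x‖ ≤ M * ‖x‖ := by
  refine hA.norm_le_of_eigenProj hM0 fun μ => ?_
  rcases le_or_gt μ 0 with hμ | hμ
  · simp only [hA.eigenProj_eq_zero_of_nonpos hμ, norm_zero, mul_zero, le_refl]
  · rw [hL μ hμ, norm_smul, RCLike.norm_ofReal]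
    exact mul_le_mul_of_nonneg_right (hM μ hμ) (norm_nonneg _)

theorem sub (hL : IsMultiplier A m L) (hL' : IsMultiplier A m' L') :
    IsMultiplier A (fun μ => m μ - m' μ) (L - L') := fun μ hμ x => by
  rw [sub_apply, map_sub, hL μ hμ, hL' μ hμ, RCLike.ofReal_sub, sub_smul]

theorem comp (hL : IsMultiplier A m L) (hL' : IsMultiplier A m' L') :
    IsMultiplier A (fun μ => m μ * m' μ) (L.comp L') := fun μ hμ x => by
  rw [ContinuousLinearMap.comp_apply, hL μ hμ, hL' μ hμ, RCLike.ofReal_mul, mul_smul]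

theorem ext (hA : A1 A) (hL : IsMultiplier A m L) (hL' : IsMultiplier A m' L')
    (h : ∀ μ, 0 < μ → m μ = m' μ) : L = L' :=
  ContinuousLinearMap.ext fun x => hA.ext_eigenProj fun μ hμ => by
    rw [hL μ hμ, hL' μ hμ, h μ hμ]

theorem inner_left (hA : A1 A) (hL : IsMultiplier A m L) (x y : H) :
    inner 𝕜 (L x) y = inner 𝕜 x (L y) := by
  have h1 := (innerSL 𝕜 (L x)).hasSum (hA.hasSum_eigenProj y)
  have h2 := (innerSL 𝕜 x).hasSum (hA.hasSum_eigenProj (L y))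
  simp only [innerSL_apply_apply] at h1 h2
  refine h1.unique (h2.congr_fun fun μ => ?_)
  rcases le_or_gt μ 0 with hμ | hμ
  · simp only [hA.eigenProj_eq_zero_of_nonpos hμ, inner_zero_right]
  · rw [hL μ hμ, inner_smul_right, ← inner_eigenProj_left, hL μ hμ, inner_smul_left,
      RCLike.conj_ofReal, inner_eigenProj_left]

end IsMultiplier

theorem fracPow_neg (s : ℝ) (u : H) : fracPow A s (-u) = -fracPow A s u := by
  simp only [fracPow, map_neg, smul_neg, tsum_neg]

theorem zero_mem_powDom (s : ℝ) : (0 : H) ∈ powDom A s := by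
  simp only [powDom, mem_ofPred_eq, map_zero, smul_zero, summable_zero]

theorem fracPow_zero_right (s : ℝ) : fracPow A s (0 : H) = 0 := by
  simp only [fracPow, map_zero, smul_zero, tsum_zero]

theorem energy_nonneg (k : ℤ) (u v : H) : 0 ≤ energy A k u v := by
  unfold energy; positivity

theorem energy_zero (k : ℤ) : energy A k (0 : H) 0 = 0 := by
  simp [energy, fracPow_zero_right]

namespace A1

theorem fracPow_eq (hA : A1 A) {s : ℝ} {u y : H}
    (h : ∀ μ : ℝ, 0 < μ → ((μ ^ s : ℝ) : 𝕜) • eigenProj A μ u = eigenProj A μ y) :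
    u ∈ powDom A s ∧ fracPow A s u = y := by
  have hs : HasSum (fun μ : ℝ => ((μ ^ s : ℝ) : 𝕜) • eigenProj A μ u) y := by
    refine (hA.hasSum_eigenProj y).congr_fun fun μ => ?_
    rcases le_or_gt μ 0 with hμ | hμ
    · simp only [hA.eigenProj_eq_zero_of_nonpos hμ, smul_zero]
    · exact h μ hμ
  exact ⟨hs.summable, hs.tsum_eq⟩

theorem eigenProj_fracPow (hA : A1 A) {s : ℝ} {u : H} (h : u ∈ powDom A s) (μ : ℝ) :
    eigenProj A μ (fracPow A s u) = ((μ ^ s : ℝ) : 𝕜) • eigenProj A μ u :=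
  hA.eigenProj_hasSum (fun ν => Submodule.smul_mem _ _ (hA.eigenProj_mem ν u))
    (Summable.hasSum h) μ

theorem fracPow_map (hA : A1 A) (s : ℝ) (u : A.domain) :
    fracPow A s (A u) = fracPow A (s + 1) (u : H) := by
  refine tsum_congr fun μ => ?_
  rcases le_or_gt μ 0 with h | h
  · simp only [hA.eigenProj_eq_zero_of_nonpos h, smul_zero]
  · rw [hA.eigenProj_map, smul_smul, Real.rpow_add_one h.ne', RCLike.ofReal_mul]

theorem fracPow_zero_left (hA : A1 A) (u : H) : fracPow A 0 u = u :=
  (hA.fracPow_eq fun μ _ => by rw [Real.rpow_zero, RCLike.ofReal_one, one_smul]).2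

theorem energy_one (hA : A1 A) (u v : H) :
    energy A 1 u v = (‖fracPow A (1 / 2) u‖ ^ 2 + ‖v‖ ^ 2) / 2 := by
  unfold energy
  norm_num [hA.fracPow_zero_left]

/-- Differentiating in time a free solution, whose state `(u, v)` becomes `(v, -A u)`, lowers the
level of the energy by one. -/
theorem energy_shift (hA : A1 A) (k : ℤ) (u : A.domain) (v : H) :
    energy A (k - 1) v (-A u) = energy A k (u : H) v := by
  unfold energy
  rw [fracPow_neg, norm_neg, hA.fracPow_map]
  push_cast
  rw [show ((k : ℝ) - 1 - 1) / 2 + 1 = k / 2 by ring, add_comm]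

theorem exists_isMultiplier_rpow_neg_half (hA : A1 A) :
    ∃ Q : H →L[𝕜] H, IsMultiplier A (fun μ => μ ^ (-(1 / 2) : ℝ)) Q := by
  obtain ⟨ω, hω, h⟩ := hA.exists_pos_le_eigenvalue
  refine hA.exists_isMultiplier (M := ω ^ (-(1 / 2) : ℝ)) fun μ u hu hu0 => ?_
  have hle := h μ u hu hu0
  rw [abs_of_nonneg (Real.rpow_nonneg (hω.le.trans hle) _)]
  exact Real.rpow_le_rpow_of_nonpos hω hle (by norm_num)

/-- The bounded operator `A^{-1/2}`. -/
def invSqrt (hA : A1 A) : H →L[𝕜] H := hA.exists_isMultiplier_rpow_neg_half.choose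

theorem isMultiplier_invSqrt (hA : A1 A) :
    IsMultiplier A (fun μ => μ ^ (-(1 / 2) : ℝ)) hA.invSqrt :=
  hA.exists_isMultiplier_rpow_neg_half.choose_spec

theorem invSqrt_comp_invSqrt (hA : A1 A) : hA.invSqrt.comp hA.invSqrt = hA.inv :=
  (hA.isMultiplier_invSqrt.comp hA.isMultiplier_invSqrt).ext hA hA.isMultiplier_inv fun μ hμ => by
    rw [← Real.rpow_add hμ, ← Real.rpow_neg_one]
    norm_num

theorem fracPow_invSqrt (hA : A1 A) (x : H) :
    hA.invSqrt x ∈ powDom A (1 / 2) ∧ fracPow A (1 / 2) (hA.invSqrt x) = x :=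
  hA.fracPow_eq fun μ hμ => by
    rw [hA.isMultiplier_invSqrt μ hμ, smul_smul, ← RCLike.ofReal_mul, ← Real.rpow_add hμ,
      add_neg_cancel, Real.rpow_zero, RCLike.ofReal_one, one_smul]

theorem fracPow_half (hA : A1 A) (u : A.domain) :
    (u : H) ∈ powDom A (1 / 2) ∧ fracPow A (1 / 2) (u : H) = hA.invSqrt (A u) := by
  have hu : (u : H) = hA.invSqrt (hA.invSqrt (A u)) := by
    rw [← ContinuousLinearMap.comp_apply, hA.invSqrt_comp_invSqrt, hA.inv_map]
  rw [hu]
  exact hA.fracPow_invSqrt _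

theorem norm_fracPow_half_sq (hA : A1 A) (u : A.domain) :
    ‖fracPow A (1 / 2) (u : H)‖ ^ 2 = RCLike.re (inner 𝕜 (A u) (u : H)) := by
  rw [(hA.fracPow_half u).2, ← inner_self_eq_norm_sq (𝕜 := 𝕜),
    hA.isMultiplier_invSqrt.inner_left hA, ← ContinuousLinearMap.comp_apply,
    hA.invSqrt_comp_invSqrt, hA.inv_map]

end A1

open scoped ContDiff

section Calculus

variable {E : Type*} [NormedAddCommGroup E]

theorem memLp_of_continuousOn {f : ℝ → E} {K : Set ℝ} {p : ENNReal} (hK : IsCompact K)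
    (hf : ContinuousOn f K) : MemLp f p (volume.restrict K) := by
  have : IsFiniteMeasure (volume.restrict K) := isFiniteMeasure_restrict.2 hK.measure_lt_top.ne
  obtain ⟨M, hM⟩ := hK.exists_bound_of_continuousOn hf
  exact MemLp.of_bound (hf.aestronglyMeasurable hK.measurableSet) M
    ((ae_restrict_iff' hK.measurableSet).2 (Eventually.of_forall hM))

theorem le_exp_mul_integral_of_deriv_le {e e' φ : ℝ → ℝ} (he : ∀ t, HasDerivAt e (e' t) t)
    (hφ : Continuous φ) (hφ0 : ∀ t, 0 ≤ φ t) (hle : ∀ t, e' t ≤ e t + φ t) (h0 : e 0 ≤ 0) {t : ℝ}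
    (ht : 0 ≤ t) : e t ≤ Real.exp t * ∫ s in (0 : ℝ)..t, φ s := by
  let g : ℝ → ℝ := fun t => Real.exp (-t) * e t - ∫ s in (0 : ℝ)..t, φ s
  have hg (t) : HasDerivAt g (Real.exp (-t) * -1 * e t + Real.exp (-t) * e' t - φ t) t :=
    ((hasDerivAt_neg t).exp.mul (he t)).sub (hφ.integral_hasStrictDerivAt 0 t).hasDerivAt
  have hanti : AntitoneOn g (Ici 0) := by
    refine antitoneOn_of_deriv_nonpos (convex_Ici 0)
      (fun t _ => (hg t).continuousAt.continuousWithinAt)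
      (fun t _ => (hg t).differentiableAt.differentiableWithinAt) fun t ht => ?_
    rw [interior_Ici, mem_Ioi] at ht
    rw [(hg t).deriv]
    have hexp : Real.exp (-t) ≤ 1 := Real.exp_le_one_iff.2 (neg_nonpos.2 ht.le)
    nlinarith [mul_le_mul_of_nonneg_left (hle t) (Real.exp_pos (-t)).le,
      mul_le_mul_of_nonneg_right hexp (hφ0 t)]
  have hgt : Real.exp (-t) * e t - ∫ s in (0 : ℝ)..t, φ s ≤ 0 :=
    (hanti self_mem_Ici ht ht).trans (by simpa [g] using h0)
  calc e t = Real.exp t * (Real.exp (-t) * e t) := by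
        rw [← mul_assoc, ← Real.exp_add, add_neg_cancel, Real.exp_zero, one_mul]
    _ ≤ Real.exp t * ∫ s in (0 : ℝ)..t, φ s := by
        gcongr
        linarith

variable [NormedSpace ℝ E] {f : ℝ → E}

theorem hasDerivAt_of_contDiff (hf : ContDiff ℝ ∞ f) (t : ℝ) : HasDerivAt f (deriv f t) t :=
  ((contDiff_infty_iff_deriv.1 hf).1 t).hasDerivAt

theorem contDiff_deriv (hf : ContDiff ℝ ∞ f) : ContDiff ℝ ∞ (deriv f) :=
  (contDiff_infty_iff_deriv.1 hf).2

theorem deriv_eq_zero_of_nonpos (hf : ContDiff ℝ ∞ f) (h0 : ∀ t ≤ 0, f t = 0) :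
    ∀ t ≤ 0, deriv f t = 0 := by
  have hclosed : IsClosed {t | deriv f t = 0} :=
    isClosed_eq (contDiff_deriv hf).continuous continuous_const
  have hneg : Iio (0 : ℝ) ⊆ {t | deriv f t = 0} := fun t ht => by
    have : f =ᶠ[𝓝 t] fun _ => 0 := by
      filter_upwards [Iio_mem_nhds ht] with s hs using h0 s (le_of_lt hs)
    simpa using this.deriv_eq
  intro t ht
  rw [← mem_Iic, ← closure_Iio] at ht
  exact closure_minimal hneg hclosed ht

/-- Duhamel's formula for `g'' + r² g`, when `g` starts from rest. -/
theorem integral_sin_div_smul_eq [CompleteSpace E] {g : ℝ → E} (hg : ContDiff ℝ ∞ g)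
    (h0 : g 0 = 0) (h0' : deriv g 0 = 0) {r : ℝ} (hr : r ≠ 0) (t : ℝ) :
    ∫ s in (0 : ℝ)..t, (Real.sin (r * s) / r) • (deriv (deriv g) (t - s) + r ^ 2 • g (t - s)) =
      g t := by
  have hg' := contDiff_deriv hg
  have hcos (s) : HasDerivAt (fun s => Real.cos (r * s)) (-(r * Real.sin (r * s))) s := by
    simpa [mul_comm] using ((hasDerivAt_id s).const_mul r).cos
  have hsin (s) : HasDerivAt (fun s => Real.sin (r * s) / r) (Real.cos (r * s)) s := by
    simpa [hr] using (((hasDerivAt_id s).const_mul r).sin).div_const r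
  have hrev {g : ℝ → E} (hg : ContDiff ℝ ∞ g) (s) :
      HasDerivAt (fun s => g (t - s)) (-deriv g (t - s)) s := by
    simpa using (hasDerivAt_of_contDiff hg (t - s)).comp_const_sub t s
  have hprim (s) : HasDerivAt
      (fun s => -(Real.cos (r * s) • g (t - s)) - (Real.sin (r * s) / r) • deriv g (t - s))
      ((Real.sin (r * s) / r) • (deriv (deriv g) (t - s) + r ^ 2 • g (t - s))) s := by
    refine (((hcos s).smul (hrev hg s)).neg.sub ((hsin s).smul (hrev hg' s))).congr_deriv ?_
    have : Real.sin (r * s) / r * r ^ 2 = r * Real.sin (r * s) := by field_simp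
    rw [smul_add, smul_smul, this]
    module
  have hcont : Continuous fun s =>
      (Real.sin (r * s) / r) • (deriv (deriv g) (t - s) + r ^ 2 • g (t - s)) := by
    have := (contDiff_deriv hg').continuous
    have := hg.continuous
    fun_prop
  rw [intervalIntegral.integral_eq_sub_of_hasDerivAt (fun s _ => hprim s)
    (hcont.intervalIntegrable _ _)]
  simp [h0, h0']

end Calculus

section RestrictScalars

variable {E F : Type*} [NormedAddCommGroup E] [NormedSpace 𝕜 E] [NormedSpace ℝ E]
  [IsScalarTower ℝ 𝕜 E] [NormedAddCommGroup F] [NormedSpace 𝕜 F] [NormedSpace ℝ F]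
  [IsScalarTower ℝ 𝕜 F] (L : E →L[𝕜] F) {f : ℝ → E}

theorem hasDerivAt_clm {f' : E} {t : ℝ} (h : HasDerivAt f f' t) :
    HasDerivAt (fun s => L (f s)) (L f') t :=
  (L.restrictScalars ℝ).hasFDerivAt.comp_hasDerivAt t h

theorem contDiff_clm {n : WithTop ℕ∞} (h : ContDiff ℝ n f) : ContDiff ℝ n fun s => L (f s) :=
  (L.restrictScalars ℝ).contDiff.comp h

theorem iteratedDeriv_clm {k : ℕ} (h : ContDiff ℝ k f) (t : ℝ) :
    iteratedDeriv k (fun s => L (f s)) t = L (iteratedDeriv k f t) := by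
  rw [iteratedDeriv_eq_iteratedFDeriv, iteratedDeriv_eq_iteratedFDeriv]
  exact congrArg (fun T => T fun _ => 1)
    ((L.restrictScalars ℝ).iteratedFDeriv_comp_left h.contDiffAt le_rfl)

theorem contDiff_neg_clm_deriv (hf : ContDiff ℝ ∞ f) : ContDiff ℝ ∞ fun t => -L (deriv f t) :=
  (contDiff_clm L (contDiff_deriv hf)).neg

end RestrictScalars

section Duhamel

theorem abs_sin_sqrt_div_sub_le (μ s t : ℝ) :
    |Real.sin (√μ * s) / √μ - Real.sin (√μ * t) / √μ| ≤ |s - t| := by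
  rcases (Real.sqrt_nonneg μ).eq_or_lt with h | h
  · simp [← h]
  · rw [← sub_div, abs_div, abs_of_pos h, div_le_iff₀ h]
    refine (Real.abs_sin_sub_sin_le _ _).trans_eq ?_
    rw [← mul_sub, abs_mul, abs_of_pos h, mul_comm]

namespace A1

theorem exists_isMultiplier_sin_sqrt_div (hA : A1 A) (s : ℝ) :
    ∃ L, IsMultiplier A (fun μ => Real.sin (√μ * s) / √μ) L :=
  hA.exists_isMultiplier (M := |s|) fun μ _ _ _ => by simpa using abs_sin_sqrt_div_sub_le μ s 0

/-- The operator `A^{-1/2} sin (s A^{1/2})`, which maps `v` to the value at time `s` of the free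
solution with initial data `(0, v)`. -/
def sine (hA : A1 A) (s : ℝ) : H →L[𝕜] H := (hA.exists_isMultiplier_sin_sqrt_div s).choose

theorem isMultiplier_sine (hA : A1 A) (s : ℝ) :
    IsMultiplier A (fun μ => Real.sin (√μ * s) / √μ) (hA.sine s) :=
  (hA.exists_isMultiplier_sin_sqrt_div s).choose_spec

theorem continuous_sine (hA : A1 A) : Continuous hA.sine := by
  have : LipschitzWith 1 hA.sine := by
    refine LipschitzWith.of_dist_le_mul fun s t => ?_
    rw [dist_eq_norm, NNReal.coe_one, one_mul, Real.dist_eq]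
    exact ContinuousLinearMap.opNorm_le_bound _ (abs_nonneg _)
      (((hA.isMultiplier_sine s).sub (hA.isMultiplier_sine t)).norm_le hA (abs_nonneg _)
        fun μ _ => abs_sin_sqrt_div_sub_le μ s t)
  exact this.continuous

variable {f : ℝ → H}

theorem continuous_sine_apply (hA : A1 A) (hf : Continuous f) (t : ℝ) :
    Continuous fun s => hA.sine s (f (t - s)) :=
  hA.continuous_sine.clm_apply (by fun_prop)

variable [NormedSpace ℝ H]

/-- Duhamel's formula for the solution of `z'' + A z = f` with vanishing initial data. -/
def duhamel (hA : A1 A) (f : ℝ → H) (t : ℝ) : H := ∫ s in (0 : ℝ)..t, hA.sine s (f (t - s))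

theorem duhamel_of_le (hA : A1 A) (hf : Continuous f) (h0 : ∀ t ≤ 0, f t = 0) {t a : ℝ}
    (h : t ≤ a) : hA.duhamel f t = ∫ s in (0 : ℝ)..a, hA.sine s (f (t - s)) := by
  have hc := hA.continuous_sine_apply hf t
  have htail : ∫ s in t..a, hA.sine s (f (t - s)) = 0 := by
    refine (intervalIntegral.integral_congr (g := fun _ => 0) fun s hs => ?_).trans
      intervalIntegral.integral_zero
    rw [uIcc_of_le h] at hs
    simp only [h0 (t - s) (sub_nonpos.2 hs.1), map_zero]
  rw [← intervalIntegral.integral_add_adjacent_intervals (hc.intervalIntegrable 0 t)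
    (hc.intervalIntegrable t a), htail, add_zero]
  rfl

theorem duhamel_eq_zero (hA : A1 A) (hf : Continuous f) (h0 : ∀ t ≤ 0, f t = 0) :
    ∀ t ≤ 0, hA.duhamel f t = 0 := fun t ht => by
  rw [hA.duhamel_of_le hf h0 ht, intervalIntegral.integral_same]

theorem eigenProj_duhamel [IsScalarTower ℝ 𝕜 H] (hA : A1 A) (hf : Continuous f) {μ : ℝ}
    (hμ : 0 < μ) (t : ℝ) : eigenProj A μ (hA.duhamel f t) =
      ∫ s in (0 : ℝ)..t, (Real.sin (√μ * s) / √μ) • eigenProj A μ (f (t - s)) := by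
  rw [duhamel, ← ContinuousLinearMap.intervalIntegral_comp_comm _
    ((hA.continuous_sine_apply hf t).intervalIntegrable _ _)]
  refine intervalIntegral.integral_congr fun s _ => ?_
  rw [hA.isMultiplier_sine s μ hμ, RCLike.real_smul_eq_coe_smul (K := 𝕜)]

variable [IsScalarTower ℝ 𝕜 H] (hA : A1 A) (hf : ContDiff ℝ ∞ f) (h0 : ∀ t ≤ 0, f t = 0)
include hf h0

theorem hasDerivAt_duhamel (t : ℝ) :
    HasDerivAt (hA.duhamel f) (hA.duhamel (deriv f) t) t := by
  have hf' := contDiff_deriv hf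
  have heq : hA.duhamel f =ᶠ[𝓝 t] fun x => ∫ s in (0 : ℝ)..(t + 1), hA.sine s (f (x - s)) := by
    filter_upwards [Iio_mem_nhds (lt_add_one t)] with x hx
    exact hA.duhamel_of_le hf.continuous h0 (le_of_lt hx)
  rw [hA.duhamel_of_le hf'.continuous (deriv_eq_zero_of_nonpos hf h0) (lt_add_one t).le]
  refine HasDerivAt.congr_of_eventuallyEq ?_ heq
  have hc : Continuous fun p : ℝ × ℝ => hA.sine p.2 (deriv f (p.1 - p.2)) :=
    (hA.continuous_sine.comp continuous_snd).clm_apply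
      (hf'.continuous.comp (continuous_fst.sub continuous_snd))
  obtain ⟨M, hM⟩ := ((isCompact_Icc (a := t - 1) (b := t + 1)).prod
    (isCompact_uIcc (a := 0) (b := t + 1))).exists_bound_of_continuousOn hc.continuousOn
  refine (intervalIntegral.hasDerivAt_integral_of_dominated_loc_of_deriv_le
    (F' := fun x s => hA.sine s (deriv f (x - s))) (bound := fun _ => M)
    (Icc_mem_nhds (sub_one_lt t) (lt_add_one t)) ?_ ?_ ?_ ?_ ?_ ?_).2
  · exact Eventually.of_forall fun x =>
      (hA.continuous_sine_apply hf.continuous x).aestronglyMeasurable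
  · exact (hA.continuous_sine_apply hf.continuous t).intervalIntegrable _ _
  · exact (hA.continuous_sine_apply hf'.continuous t).aestronglyMeasurable
  · exact Eventually.of_forall fun s hs x hx => hM (x, s) ⟨hx, uIoc_subset_uIcc hs⟩
  · exact intervalIntegrable_const
  · exact Eventually.of_forall fun s _ x _ => hasDerivAt_clm _
      ((hasDerivAt_of_contDiff hf (x - s)).comp_sub_const x s)

theorem deriv_duhamel : deriv (hA.duhamel f) = hA.duhamel (deriv f) :=
  funext fun t => (hA.hasDerivAt_duhamel hf h0 t).deriv

theorem contDiff_duhamel : ContDiff ℝ ∞ (hA.duhamel f) := by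
  rw [contDiff_infty]
  intro n
  induction n generalizing f with
  | zero =>
    exact contDiff_zero.2 (continuous_iff_continuousAt.2 fun t =>
      (hA.hasDerivAt_duhamel hf h0 t).continuousAt)
  | succ n ih =>
    rw [Nat.cast_succ, contDiff_succ_iff_deriv]
    refine ⟨fun t => (hA.hasDerivAt_duhamel hf h0 t).differentiableAt, by simp, ?_⟩
    rw [hA.deriv_duhamel hf h0]
    exact ih (contDiff_deriv hf) (deriv_eq_zero_of_nonpos hf h0)

theorem eigenProj_duhamel_deriv_deriv_add {μ : ℝ} (hμ : 0 < μ) (t : ℝ) :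
    eigenProj A μ (hA.duhamel (deriv (deriv f)) t) + (μ : 𝕜) • eigenProj A μ (hA.duhamel f t) =
      eigenProj A μ (f t) := by
  have h0' := deriv_eq_zero_of_nonpos hf h0
  have hf'' := contDiff_deriv (contDiff_deriv hf)
  have hP {g : ℝ → H} (hg : ContDiff ℝ ∞ g) :
      deriv (fun s => eigenProj A μ (g s)) = fun s => eigenProj A μ (deriv g s) :=
    funext fun s => (hasDerivAt_clm _ (hasDerivAt_of_contDiff hg s)).deriv
  have hmode := integral_sin_div_smul_eq (contDiff_clm (eigenProj A μ) hf)
    (by rw [h0 0 le_rfl, map_zero])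
    (by rw [congrFun (hP hf) 0, h0' 0 le_rfl, map_zero]) (Real.sqrt_pos.2 hμ).ne' t
  have hint {g : ℝ → H} (hg : Continuous g) : IntervalIntegrable
      (fun s => (Real.sin (√μ * s) / √μ) • eigenProj A μ (g (t - s))) volume 0 t :=
    Continuous.intervalIntegrable (by fun_prop) _ _
  rw [← hmode, hP hf, hP (contDiff_deriv hf), hA.eigenProj_duhamel hf''.continuous hμ,
    hA.eigenProj_duhamel hf.continuous hμ, ← RCLike.real_smul_eq_coe_smul,
    ← intervalIntegral.integral_smul]
  refine (intervalIntegral.integral_add (hint hf''.continuous)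
    ((hint hf.continuous).smul μ)).symm.trans (intervalIntegral.integral_congr fun s _ => ?_)
  simp only [Real.sq_sqrt hμ.le, smul_add, Pi.smul_apply, smul_comm μ]

theorem duhamel_eq_inv (t : ℝ) :
    hA.duhamel f t = hA.inv (f t - deriv (deriv (hA.duhamel f)) t) := by
  rw [hA.deriv_duhamel hf h0, hA.deriv_duhamel (contDiff_deriv hf) (deriv_eq_zero_of_nonpos hf h0)]
  refine hA.ext_eigenProj fun μ hμ => ?_
  rw [hA.isMultiplier_inv μ hμ, map_sub, ← hA.eigenProj_duhamel_deriv_deriv_add hf h0 hμ,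
    add_sub_cancel_left, RCLike.ofReal_inv, inv_smul_smul₀ (by exact_mod_cast hμ.ne')]

end A1

end Duhamel

section SmoothSol

variable [NormedSpace ℝ H]

section

omit [CompleteSpace H]

theorem integral_inner_deriv {g : ℝ → H} (hg : ContDiff ℝ ∞ g) (φ : H) (t : ℝ) :
    ∫ s in (0 : ℝ)..t, inner 𝕜 φ (deriv g s) = inner 𝕜 φ (g t) - inner 𝕜 φ (g 0) :=
  intervalIntegral.integral_eq_sub_of_hasDerivAt
    (fun s _ => by simpa using (hasDerivAt_const s φ).inner 𝕜 (hasDerivAt_of_contDiff hg s))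
    ((continuous_const.inner (contDiff_deriv hg).continuous).intervalIntegrable _ _)

/-- A smooth solution `z : ℝ → D(A)` of `z'' + A z = f`, for all times, with a smooth source. -/
structure IsSmoothSol (A : H →ₗ.[𝕜] H) (f z : ℝ → H) : Prop where
  source : ContDiff ℝ ∞ f
  smooth : ContDiff ℝ ∞ z
  mem_domain : ∀ t, z t ∈ A.domain
  equation : ∀ t, A ⟨z t, mem_domain t⟩ = f t - deriv (deriv z) t

namespace IsSmoothSol

theorem zero : IsSmoothSol A (fun _ => 0) (fun _ => 0) where
  source := contDiff_const
  smooth := contDiff_const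
  mem_domain _ := A.domain.zero_mem
  equation t := A.map_zero.trans (by simp)

theorem add {f₁ f₂ z₁ z₂ : ℝ → H} (h₁ : IsSmoothSol A f₁ z₁) (h₂ : IsSmoothSol A f₂ z₂) :
    IsSmoothSol A (fun t => f₁ t + f₂ t) (fun t => z₁ t + z₂ t) where
  source := h₁.source.add h₂.source
  smooth := h₁.smooth.add h₂.smooth
  mem_domain t := A.domain.add_mem (h₁.mem_domain t) (h₂.mem_domain t)
  equation t := by
    have hadd {g₁ g₂ : ℝ → H} (hg₁ : ContDiff ℝ ∞ g₁) (hg₂ : ContDiff ℝ ∞ g₂) :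
        deriv (fun t => g₁ t + g₂ t) = fun t => deriv g₁ t + deriv g₂ t := funext fun t =>
      ((hasDerivAt_of_contDiff hg₁ t).add (hasDerivAt_of_contDiff hg₂ t)).deriv
    rw [hadd h₁.smooth h₂.smooth, hadd (contDiff_deriv h₁.smooth) (contDiff_deriv h₂.smooth),
      add_sub_add_comm, ← h₁.equation, ← h₂.equation, ← A.map_add]
    rfl

theorem sum {ι : Type*} {F : Finset ι} {z : ι → ℝ → H}
    (h : ∀ i ∈ F, IsSmoothSol A (fun _ => 0) (z i)) :
    IsSmoothSol A (fun _ => 0) (fun t => ∑ i ∈ F, z i t) := by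
  classical
  induction F using Finset.induction_on with
  | empty => simpa only [Finset.sum_empty] using zero
  | insert i F hi ih =>
    simp only [Finset.sum_insert hi]
    simpa only [add_zero] using (h i (Finset.mem_insert_self i F)).add
      (ih fun j hj => h j (Finset.mem_insert_of_mem hj))

theorem comp_add_const {f z : ℝ → H} (h : IsSmoothSol A f z) (a : ℝ) :
    IsSmoothSol A (fun t => f (t + a)) (fun t => z (t + a)) where
  source := h.source.comp (contDiff_id.add contDiff_const)
  smooth := h.smooth.comp (contDiff_id.add contDiff_const)
  mem_domain t := h.mem_domain (t + a)
  equation t := by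
    have hshift (g : ℝ → H) : deriv (fun t => g (t + a)) = fun t => deriv g (t + a) :=
      funext fun t => deriv_comp_add_const g a t
    rw [hshift, hshift]
    exact h.equation (t + a)

end IsSmoothSol

end

variable {f z : ℝ → H}

theorem IsSmoothSol.eq_inv (hA : A1 A) (h : IsSmoothSol A f z) (t : ℝ) :
    z t = hA.inv (f t - deriv (deriv z) t) := by
  rw [← h.equation, hA.inv_map]

theorem A1.isSmoothSol_of_eq_inv (hA : A1 A) (hf : ContDiff ℝ ∞ f) (hz : ContDiff ℝ ∞ z)
    (h : ∀ t, z t = hA.inv (f t - deriv (deriv z) t)) : IsSmoothSol A f z := by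
  have hmem (t) : z t ∈ A.domain := h t ▸ hA.inv_mem _
  refine ⟨hf, hz, hmem, fun t => ?_⟩
  rw [← hA.map_inv (f t - deriv (deriv z) t)]
  exact congrArg A (Subtype.ext (h t))

namespace IsSmoothSol

variable (hA : A1 A) (h : IsSmoothSol A f z)
include hA h

theorem isSol (T : ℝ) : IsSol A T f z (deriv z) := by
  have hz' := contDiff_deriv h.smooth
  have hz'' := (contDiff_deriv hz').continuous
  have hfrac (t) : fracPow A (1 / 2) (z t) = hA.invSqrt (f t - deriv (deriv z) t) := by
    rw [← h.equation]
    exact (hA.fracPow_half ⟨z t, h.mem_domain t⟩).2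
  refine
    { source := memLp_of_continuousOn isCompact_Icc h.source.continuous.continuousOn
      mem := fun t _ => (hA.fracPow_half ⟨z t, h.mem_domain t⟩).1
      cont := ?_
      cont' := hz'.continuous.continuousOn
      deriv := fun φ t _ => by rw [integral_inner_deriv h.smooth, add_sub_cancel]
      equation := fun φ t _ => ?_ }
  · simp only [hfrac]
    exact (hA.invSqrt.continuous.comp (h.source.continuous.sub hz'')).continuousOn
  · have hweak (s) : inner 𝕜 (A φ) (z s) =
        inner 𝕜 (φ : H) (f s) - inner 𝕜 (φ : H) (deriv (deriv z) s) := by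
      rw [← inner_sub_right, ← h.equation]
      exact hA.inner_map_left φ ⟨z s, h.mem_domain s⟩
    have hint {g : ℝ → H} (hg : Continuous g) :
        IntervalIntegrable (fun s => inner 𝕜 (φ : H) (g s)) volume 0 t :=
      (continuous_const.inner hg).intervalIntegrable _ _
    simp only [hweak]
    rw [intervalIntegral.integral_sub (hint h.source.continuous) (hint hz''),
      integral_inner_deriv hz']
    ring

theorem isStrongSol (T : ℝ) : IsStrongSol A T f (fun t => ⟨z t, h.mem_domain t⟩) (deriv z) := by
  refine ⟨h.isSol hA T, ?_⟩
  simp only [h.equation]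
  exact (h.source.continuous.sub
    (contDiff_deriv (contDiff_deriv h.smooth)).continuous).continuousOn

end IsSmoothSol

variable [IsScalarTower ℝ 𝕜 H]

theorem A1.isSmoothSol_duhamel (hA : A1 A) (hf : ContDiff ℝ ∞ f) (h0 : ∀ t ≤ 0, f t = 0) :
    IsSmoothSol A f (hA.duhamel f) :=
  hA.isSmoothSol_of_eq_inv hf (hA.contDiff_duhamel hf h0) (hA.duhamel_eq_inv hf h0)

namespace IsSmoothSol

variable (hA : A1 A) (h : IsSmoothSol A f z)
include hA h

protected theorem deriv : IsSmoothSol A (deriv f) (deriv z) := by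
  have hz' := contDiff_deriv h.smooth
  refine hA.isSmoothSol_of_eq_inv (contDiff_deriv h.source) hz' fun t => ?_
  rw [← (hasDerivAt_clm hA.inv ((hasDerivAt_of_contDiff h.source t).sub
    (hasDerivAt_of_contDiff (contDiff_deriv hz') t))).deriv]
  exact congrArg (deriv · t) (funext (h.eq_inv hA))

protected theorem iteratedDeriv (k : ℕ) :
    IsSmoothSol A (iteratedDeriv k f) (iteratedDeriv k z) := by
  induction k with
  | zero => simpa only [iteratedDeriv_zero] using h
  | succ k ih =>
    rw [iteratedDeriv_succ, iteratedDeriv_succ]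
    exact ih.deriv hA

theorem hasDerivAt_energy (t : ℝ) : HasDerivAt (fun t => energy A 1 (z t) (deriv z t))
    (RCLike.re (inner 𝕜 (deriv z t) (f t))) t := by
  have hz' := contDiff_deriv h.smooth
  let a : ℝ → H := fun t => f t - deriv (deriv z) t
  have ha : ContDiff ℝ ∞ a := h.source.sub (contDiff_deriv hz')
  have hE : (fun t => energy A 1 (z t) (deriv z t)) = fun t =>
      (RCLike.re (inner 𝕜 (a t) (z t)) + RCLike.re (inner 𝕜 (deriv z t) (deriv z t))) / 2 := by
    funext s
    rw [hA.energy_one, inner_self_eq_norm_sq, hA.norm_fracPow_half_sq ⟨z s, h.mem_domain s⟩,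
      h.equation]
  have hre {g₁ g₂ : ℝ → H} (h₁ : ContDiff ℝ ∞ g₁) (h₂ : ContDiff ℝ ∞ g₂) :
      HasDerivAt (fun t => RCLike.re (inner 𝕜 (g₁ t) (g₂ t)))
        (RCLike.re (inner 𝕜 (g₁ t) (deriv g₂ t) + inner 𝕜 (deriv g₁ t) (g₂ t))) t :=
    (RCLike.reCLM (K := 𝕜)).hasFDerivAt.comp_hasDerivAt t
      ((hasDerivAt_of_contDiff h₁ t).inner 𝕜 (hasDerivAt_of_contDiff h₂ t))
  have hsymm : inner 𝕜 (deriv a t) (z t) = inner 𝕜 (deriv z t) (a t) := by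
    rw [h.eq_inv hA t, ← hA.inner_inv_left,
      ← (hasDerivAt_clm hA.inv (hasDerivAt_of_contDiff ha t)).deriv]
    exact congrArg (fun g => inner 𝕜 (deriv g t) (a t)) (funext (h.eq_inv hA)).symm
  rw [hE]
  refine (((hre ha h.smooth).add (hre hz' hz')).div_const 2).congr_deriv ?_
  have hf : f t = a t + deriv (deriv z) t := (sub_add_cancel _ _).symm
  rw [hsymm, hf, inner_add_right]
  simp only [map_add]
  rw [inner_re_symm (a t), inner_re_symm (deriv (deriv z) t)]
  ring

omit h in
theorem energy_eq (h : IsSmoothSol A (fun _ => 0) z) (s t : ℝ) :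
    energy A 1 (z s) (deriv z s) = energy A 1 (z t) (deriv z t) := by
  have hderiv := h.hasDerivAt_energy hA
  refine is_const_of_deriv_eq_zero (f := fun t => energy A 1 (z t) (deriv z t))
    (fun t => (hderiv t).differentiableAt) (fun t => ?_) s t
  rw [(hderiv t).deriv, inner_zero_right, map_zero]

theorem energy_le (h0 : z 0 = 0) (h0' : deriv z 0 = 0) {t T : ℝ} (ht : t ∈ Icc 0 T) :
    energy A 1 (z t) (deriv z t) ≤ Real.exp T / 2 * ∫ s in (0 : ℝ)..T, ‖f s‖ ^ 2 := by
  have hf : Continuous fun s => ‖f s‖ ^ 2 / 2 := by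
    have := h.source.continuous
    fun_prop
  have hgronwall : energy A 1 (z t) (deriv z t) ≤
      Real.exp t * ∫ s in (0 : ℝ)..t, ‖f s‖ ^ 2 / 2 := by
    refine le_exp_mul_integral_of_deriv_le (h.hasDerivAt_energy hA) hf
      (fun s => by positivity) (fun s => ?_) (by rw [h0, h0', energy_zero]) ht.1
    have hcs : RCLike.re (inner 𝕜 (deriv z s) (f s)) ≤ ‖deriv z s‖ * ‖f s‖ :=
      re_inner_le_norm _ _
    rw [hA.energy_one]
    nlinarith [sq_nonneg (‖deriv z s‖ - ‖f s‖), sq_nonneg ‖fracPow A (1 / 2) (z s)‖]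
  calc energy A 1 (z t) (deriv z t)
      ≤ Real.exp t * ∫ s in (0 : ℝ)..t, ‖f s‖ ^ 2 / 2 := hgronwall
    _ ≤ Real.exp T * ∫ s in (0 : ℝ)..T, ‖f s‖ ^ 2 / 2 := by
        gcongr
        · exact intervalIntegral.integral_nonneg ht.1 fun _ _ => by positivity
        · exact ht.2
        · exact intervalIntegral.integral_mono_interval le_rfl ht.1 ht.2
            (Eventually.of_forall fun _ => by positivity) (hf.intervalIntegrable _ _)
    _ = Real.exp T / 2 * ∫ s in (0 : ℝ)..T, ‖f s‖ ^ 2 := by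
        rw [intervalIntegral.integral_div]
        ring

theorem integral_norm_deriv_sq_le (h0 : z 0 = 0) (h0' : deriv z 0 = 0) {T : ℝ} (hT : 0 ≤ T) :
    ∫ t in (0 : ℝ)..T, ‖deriv z t‖ ^ 2 ≤ T * Real.exp T * ∫ t in (0 : ℝ)..T, ‖f t‖ ^ 2 := by
  have hz' := (contDiff_deriv h.smooth).continuous
  have hle : ∀ t ∈ Icc 0 T, ‖deriv z t‖ ^ 2 ≤ Real.exp T * ∫ t in (0 : ℝ)..T, ‖f t‖ ^ 2 := by
    intro t ht
    have hE := h.energy_le hA h0 h0' ht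
    rw [hA.energy_one] at hE
    linarith [sq_nonneg ‖fracPow A (1 / 2) (z t)‖]
  refine (intervalIntegral.integral_mono_on hT ((hz'.norm.pow 2).intervalIntegrable _ _)
    intervalIntegrable_const hle).trans_eq ?_
  rw [intervalIntegral.integral_const, sub_zero, smul_eq_mul, mul_assoc]

omit h in
theorem energy_iteratedDeriv (hw : IsSmoothSol A (fun _ => 0) z) (k : ℕ) (t : ℝ) :
    energy A (1 - k) (iteratedDeriv k z t) (iteratedDeriv (k + 1) z t) =
      energy A 1 (z t) (deriv z t) := by
  induction k with
  | zero => simp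
  | succ k ih =>
    have hk := hw.iteratedDeriv hA k
    have hvel : -A ⟨iteratedDeriv k z t, hk.mem_domain t⟩ = iteratedDeriv (k + 1 + 1) z t := by
      rw [hk.equation, iteratedDeriv_succ, iteratedDeriv_succ]
      simp
    rw [← ih, ← hA.energy_shift _ ⟨_, hk.mem_domain t⟩, hvel, Nat.cast_succ, sub_add_eq_sub_sub]

end IsSmoothSol

end SmoothSol

section Observation

variable {G : Type*} [NormedAddCommGroup G] [InnerProductSpace 𝕜 G] {B : A.domain × H →ₗ[𝕜] G}

theorem IsSol.congr_source {T : ℝ} {f g w w' : ℝ → H} (h : IsSol A T f w w')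
    (hfg : ∀ t ∈ Icc 0 T, f t = g t) : IsSol A T g w w' where
  source := h.source.ae_eq ((ae_restrict_iff' measurableSet_Icc).2 (Eventually.of_forall hfg))
  mem := h.mem
  cont := h.cont
  cont' := h.cont'
  deriv := h.deriv
  equation φ t ht := by
    rw [h.equation φ t ht]
    congr 1
    refine intervalIntegral.integral_congr fun s hs => ?_
    rw [uIcc_of_le ht.1] at hs
    rw [hfg s ⟨hs.1, hs.2.trans ht.2⟩]

theorem IsStrongSol.isObservation (hB : A4 A B) {T : ℝ} {f : ℝ → H} {w : ℝ → A.domain}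
    {w' : ℝ → H} (h : IsStrongSol A T f w w') :
    IsObservation A B T f (fun t => (w t : H)) w' (fun t => B (w t, w' t)) := by
  obtain ⟨⟨M, hM⟩, -⟩ := hB
  have hcont : ContinuousOn (fun t => B (w t, w' t)) (Icc 0 T) := fun t ht => by
    have hlim : Tendsto (fun s => M * (‖A (w s) - A (w t)‖ + ‖w' s - w' t‖)) (𝓝[Icc 0 T] t)
        (𝓝 (M * (0 + 0))) :=
      tendsto_const_nhds.mul ((tendsto_iff_norm_sub_tendsto_zero.1 (h.2 t ht)).add
        (tendsto_iff_norm_sub_tendsto_zero.1 (h.1.cont' t ht)))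
    rw [add_zero, mul_zero] at hlim
    refine tendsto_iff_norm_sub_tendsto_zero.2
      (squeeze_zero (fun _ => norm_nonneg _) (fun s => ?_) hlim)
    rw [← map_sub, Prod.mk_sub_mk, ← A.map_sub]
    exact hM _ _
  exact ⟨memLp_of_continuousOn isCompact_Icc hcont, fun _ => f, fun _ => w, fun _ => w',
    fun _ => h, fun _ hu => Eventually.of_forall fun _ _ _ => refl_mem_uniformity hu,
    fun _ hu => Eventually.of_forall fun _ _ _ => refl_mem_uniformity hu, by simp, by simp⟩

variable [NormedSpace ℝ H] [IsScalarTower ℝ 𝕜 H]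

theorem A4.exists_integral_le (hB : A4 A B) (hA : A1 A) {T a : ℝ} (hT : 0 < T) (ha : 0 ≤ a) :
    ∃ D, 0 < D ∧ ∀ f z (h : IsSmoothSol A f z), z 0 = 0 → deriv z 0 = 0 →
      ∫ t in (0 : ℝ)..T, ‖B (⟨z (t + a), h.mem_domain (t + a)⟩, deriv z (t + a))‖ ^ 2 ≤
        D * ∫ t in (0 : ℝ)..(T + a), ‖f t‖ ^ 2 := by
  obtain ⟨D, hD, hle⟩ := hB.2 T hT
  refine ⟨D * (Real.exp (T + a) / 2 * (2 + T) + 1), by positivity, fun f z h h0 h0' => ?_⟩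
  have hshift : deriv (fun t => z (t + a)) = fun t => deriv z (t + a) :=
    funext fun t => deriv_comp_add_const z a t
  have hadm := hle _ _ _ ((h.comp_add_const a).isStrongSol hA T)
  rw [hshift] at hadm
  set I := ∫ t in (0 : ℝ)..(T + a), ‖f t‖ ^ 2
  set e := fun t => energy A 1 (z (t + a)) (deriv z (t + a))
  have hE : ∀ t ∈ Icc 0 T, e t ≤ Real.exp (T + a) / 2 * I := fun t ht =>
    h.energy_le hA h0 h0' ⟨add_nonneg ht.1 ha, by linarith [ht.2]⟩
  have hEc : Continuous e :=
    (continuous_iff_continuousAt.2 fun t => (h.hasDerivAt_energy hA t).continuousAt).comp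
      (continuous_add_const a)
  have hEint : ∫ t in (0 : ℝ)..T, e t ≤ T * (Real.exp (T + a) / 2 * I) := by
    refine (intervalIntegral.integral_mono_on hT.le (hEc.intervalIntegrable _ _)
      intervalIntegrable_const hE).trans_eq ?_
    rw [intervalIntegral.integral_const, smul_eq_mul, sub_zero]
  have hf : ∫ t in (0 : ℝ)..T, ‖f (t + a)‖ ^ 2 ≤ I := by
    rw [intervalIntegral.integral_comp_add_right (fun t => ‖f t‖ ^ 2), zero_add]
    exact intervalIntegral.integral_mono_interval ha (by linarith) le_rfl
      (Eventually.of_forall fun _ => sq_nonneg _)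
      ((h.source.continuous.norm.pow 2).intervalIntegrable _ _)
  refine hadm.trans ?_
  rw [mul_assoc D]
  refine mul_le_mul_of_nonneg_left ?_ hD.le
  linarith [hE 0 ⟨le_rfl, hT.le⟩, hE T ⟨hT.le, le_rfl⟩]

end Observation

section SwitchOn

variable {E : Type*} [NormedAddCommGroup E] [NormedSpace ℝ E] {g : ℝ → E} {t : ℝ}

/-- The function `g`, multiplied by a smooth cutoff in time which vanishes for `t ≤ 0` and is equal
to `1` for `t ≥ 1 / 2`. -/
def switchOn (g : ℝ → E) (t : ℝ) : E := Real.smoothTransition (2 * t) • g t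

theorem contDiff_switchOn (hg : ContDiff ℝ ∞ g) : ContDiff ℝ ∞ (switchOn g) :=
  (Real.smoothTransition.contDiff.comp (contDiff_const.mul contDiff_id)).smul hg

theorem switchOn_eq_zero (ht : t ≤ 0) : switchOn g t = 0 := by
  rw [switchOn, Real.smoothTransition.zero_of_nonpos (by linarith), zero_smul]

theorem switchOn_eq_self (ht : 1 / 2 ≤ t) : switchOn g t = g t := by
  rw [switchOn, Real.smoothTransition.one_of_one_le (by linarith), one_smul]

theorem norm_switchOn_le (g : ℝ → E) (t : ℝ) : ‖switchOn g t‖ ≤ ‖g t‖ := by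
  rw [switchOn, norm_smul, Real.norm_of_nonneg (Real.smoothTransition.nonneg _)]
  exact mul_le_of_le_one_left (norm_nonneg _) (Real.smoothTransition.le_one _)

end SwitchOn

section VelocityCascade

variable [NormedSpace ℝ H] (C : ℕ → H →L[𝕜] H) {w : ℝ → H}

namespace A1

/-- The solutions `V 0 = w` and `V (k + 1)'' + A V (k + 1) = -C k (V k)'`, where the source is
switched on smoothly between `t = 0` and `t = 1 / 2`, and `V (k + 1)` is at rest before. -/
def velocityCascade (hA : A1 A) (w : ℝ → H) : ℕ → ℝ → H
  | 0 => w
  | k + 1 => hA.duhamel (switchOn fun t => -C k (deriv (hA.velocityCascade w k) t))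

variable [IsScalarTower ℝ 𝕜 H]

variable (hA : A1 A) (hw : ContDiff ℝ ∞ w)
include hw

theorem contDiff_velocityCascade (k : ℕ) : ContDiff ℝ ∞ (hA.velocityCascade C w k) := by
  induction k with
  | zero => exact hw
  | succ k ih =>
    exact hA.contDiff_duhamel (contDiff_switchOn (contDiff_neg_clm_deriv (C k) ih))
      fun t => switchOn_eq_zero

theorem isSmoothSol_velocityCascade_succ (k : ℕ) :
    IsSmoothSol A (switchOn fun t => -C k (deriv (hA.velocityCascade C w k) t))
      (hA.velocityCascade C w (k + 1)) :=
  hA.isSmoothSol_duhamel (contDiff_switchOn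
    (contDiff_neg_clm_deriv (C k) (hA.contDiff_velocityCascade C hw k))) fun _ => switchOn_eq_zero

theorem velocityCascade_succ_eq_zero (k : ℕ) :
    ∀ t ≤ 0, hA.velocityCascade C w (k + 1) t = 0 :=
  hA.duhamel_eq_zero (contDiff_switchOn (contDiff_neg_clm_deriv (C k)
    (hA.contDiff_velocityCascade C hw k))).continuous fun _ => switchOn_eq_zero

theorem deriv_velocityCascade_succ_eq_zero (k : ℕ) :
    ∀ t ≤ 0, deriv (hA.velocityCascade C w (k + 1)) t = 0 :=
  deriv_eq_zero_of_nonpos (hA.contDiff_velocityCascade C hw (k + 1))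
    (hA.velocityCascade_succ_eq_zero C hw k)

theorem integral_switchOn_velocityCascade_le (k : ℕ) {T : ℝ} (hT : 0 ≤ T) :
    ∫ t in (0 : ℝ)..T, ‖switchOn (fun t => -C k (deriv (hA.velocityCascade C w k) t)) t‖ ^ 2 ≤
      ∫ t in (0 : ℝ)..T, ‖C k (deriv (hA.velocityCascade C w k) t)‖ ^ 2 := by
  have hsmooth := contDiff_neg_clm_deriv (C k) (hA.contDiff_velocityCascade C hw k)
  refine intervalIntegral.integral_mono_on hT
    (((contDiff_switchOn hsmooth).continuous.norm.pow 2).intervalIntegrable _ _) ?_ fun t _ => ?_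
  · have hcont := hsmooth.continuous.norm
    simp only [norm_neg] at hcont
    exact (hcont.pow 2).intervalIntegrable _ _
  · gcongr
    simpa only [norm_neg] using
      norm_switchOn_le (fun t => -C k (deriv (hA.velocityCascade C w k) t)) t

omit hw in
theorem exists_integral_velocityCascade_le {T : ℝ} (hT : 0 ≤ T) (k : ℕ) :
    ∃ M : ℝ, 0 ≤ M ∧ ∀ w : ℝ → H, ContDiff ℝ ∞ w →
      ∫ t in (0 : ℝ)..T, ‖C k (deriv (hA.velocityCascade C w k) t)‖ ^ 2 ≤
        M * ∫ t in (0 : ℝ)..T, ‖C 0 (deriv w t)‖ ^ 2 := by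
  induction k with
  | zero => exact ⟨1, zero_le_one, fun w _ => (one_mul _).ge⟩
  | succ k ih =>
    obtain ⟨M, hM, ih⟩ := ih
    refine ⟨‖C (k + 1)‖ ^ 2 * (T * Real.exp T * M), by positivity, fun w hw => ?_⟩
    have hV := hA.contDiff_velocityCascade C hw (k + 1)
    calc ∫ t in (0 : ℝ)..T, ‖C (k + 1) (deriv (hA.velocityCascade C w (k + 1)) t)‖ ^ 2
        ≤ ∫ t in (0 : ℝ)..T, ‖C (k + 1)‖ ^ 2 * ‖deriv (hA.velocityCascade C w (k + 1)) t‖ ^ 2 := by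
          have hV' := (contDiff_deriv hV).continuous
          refine intervalIntegral.integral_mono_on hT
            (Continuous.intervalIntegrable (by fun_prop) _ _)
            (Continuous.intervalIntegrable (by fun_prop) _ _) fun t _ => ?_
          rw [← mul_pow]
          gcongr
          exact (C (k + 1)).le_opNorm _
      _ = ‖C (k + 1)‖ ^ 2 *
            ∫ t in (0 : ℝ)..T, ‖deriv (hA.velocityCascade C w (k + 1)) t‖ ^ 2 :=
          intervalIntegral.integral_const_mul _ _
      _ ≤ ‖C (k + 1)‖ ^ 2 * (T * Real.exp T *
            (M * ∫ t in (0 : ℝ)..T, ‖C 0 (deriv w t)‖ ^ 2)) := by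
          gcongr
          refine ((hA.isSmoothSol_velocityCascade_succ C hw k).integral_norm_deriv_sq_le hA
            (hA.velocityCascade_succ_eq_zero C hw k 0 le_rfl)
            (hA.deriv_velocityCascade_succ_eq_zero C hw k 0 le_rfl) hT).trans ?_
          gcongr
          exact (hA.integral_switchOn_velocityCascade_le C hw k hT).trans (ih w hw)
      _ = ‖C (k + 1)‖ ^ 2 * (T * Real.exp T * M) * ∫ t in (0 : ℝ)..T, ‖C 0 (deriv w t)‖ ^ 2 := by
          ring

end A1

end VelocityCascade

section Cascade

variable {C : ℕ → H →L[𝕜] H} {n : ℕ} {T : ℝ}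

theorem IsSol.zero : IsSol A T (fun _ => 0) (fun _ => 0) fun _ => 0 where
  source := MemLp.zero'
  mem _ _ := zero_mem_powDom _
  cont := continuousOn_const
  cont' := continuousOn_const
  deriv φ t _ := by simp
  equation φ t _ := by simp

theorem isCascadeSol_of_eq_zero {m : ℕ} (hm : 1 ≤ m) {u v : ℕ → ℝ → H}
    (hu : ∀ j < m, u j = fun _ => 0) (hv : ∀ j < m, v j = fun _ => 0)
    (hsol : IsSol A T (fun _ => 0) (u m) (v m))
    (hsucc : ∀ j, m < j → j ≤ n → IsSol A T (fun t => -C j (u (j - 1) t)) (u j) (v j)) :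
    IsCascadeSol A C n T u v := by
  have hfree : ∀ j ≤ m, IsSol A T (fun _ => 0) (u j) (v j) := fun j hj => by
    rcases hj.lt_or_eq with hj | rfl
    · rw [hu j hj, hv j hj]
      exact IsSol.zero
    · exact hsol
  refine ⟨hfree 1 hm, fun j hj => ?_⟩
  obtain ⟨hj2, hjn⟩ := Finset.mem_Icc.1 hj
  rcases le_or_gt j m with hjm | hjm
  · simpa only [hu (j - 1) (by omega), map_zero, neg_zero] using hfree j hjm
  · exact hsucc j hjm hjn

theorem energy_le_sum_energy {m : ℕ} (hm : m ∈ Finset.Icc 1 n) (u v : ℕ → H) :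
    energy A (1 + (m : ℤ) - n) (u m) (v m) ≤
      ∑ j ∈ Finset.Icc 1 n, energy A (1 + (j : ℤ) - n) (u j) (v j) :=
  Finset.single_le_sum (f := fun j : ℕ => energy A (1 + (j : ℤ) - n) (u j) (v j))
    (fun _ _ => energy_nonneg _ _ _) hm

variable [NormedSpace ℝ H]

namespace A1

/-- The cascade solution of size `n` to which observability is applied: component `j ≥ m` is the
derivative of order `n - j` of `velocityCascade`, so that the coupling with `(V k)'` turns into the
coupling with the component `j - 1` itself. The shift in time starts the clock after the sources of
`velocityCascade` have been switched on; the truncated differences matter only for `m ≤ j ≤ n`. -/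
def cascade (hA : A1 A) (C : ℕ → H →L[𝕜] H) (w : ℝ → H) (m n j : ℕ) (t : ℝ) : H :=
  if j < m then 0
  else iteratedDeriv (n - j) (hA.velocityCascade (fun k => C (m + k + 1)) w (j - m)) (t + 1)

variable (hA : A1 A) {w : ℝ → H} {m : ℕ}

theorem cascade_of_lt {j : ℕ} (h : j < m) : hA.cascade C w m n j = fun _ => 0 :=
  funext fun _ => if_pos h

theorem cascade_add (k : ℕ) : hA.cascade C w m n (m + k) = fun t =>
    iteratedDeriv (n - (m + k)) (hA.velocityCascade (fun k => C (m + k + 1)) w k) (t + 1) :=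
  funext fun t => by rw [cascade, if_neg (by omega), Nat.add_sub_cancel_left]

theorem cascade_self : hA.cascade C w m n m = fun t => iteratedDeriv (n - m) w (t + 1) :=
  hA.cascade_add 0

variable [IsScalarTower ℝ 𝕜 H]

theorem isSmoothSol_cascade_self (hw : IsSmoothSol A (fun _ => 0) w) :
    IsSmoothSol A (fun _ => 0) (hA.cascade C w m n m) := by
  rw [cascade_self]
  simpa using (hw.iteratedDeriv hA (n - m)).comp_add_const 1

theorem isSmoothSol_cascade_succ (hw : ContDiff ℝ ∞ w) (k : ℕ) :
    IsSmoothSol A (fun t => iteratedDeriv (n - (m + k + 1)) (switchOn fun t =>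
        -C (m + k + 1) (deriv (hA.velocityCascade (fun k => C (m + k + 1)) w k) t)) (t + 1))
      (hA.cascade C w m n (m + k + 1)) := by
  have h := ((hA.isSmoothSol_velocityCascade_succ (fun k => C (m + k + 1)) hw k).iteratedDeriv hA
    (n - (m + k + 1))).comp_add_const 1
  rwa [add_assoc m k 1, hA.cascade_add (k + 1), ← add_assoc]

theorem iteratedDeriv_switchOn_eq (hw : ContDiff ℝ ∞ w) {k : ℕ} (hk : m + k + 1 ≤ n) {t : ℝ}
    (ht : 0 ≤ t) :
    iteratedDeriv (n - (m + k + 1)) (switchOn fun t =>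
        -C (m + k + 1) (deriv (hA.velocityCascade (fun k => C (m + k + 1)) w k) t)) (t + 1) =
      -C (m + k + 1) (hA.cascade C w m n (m + k) t) := by
  have hV := hA.contDiff_velocityCascade (fun k => C (m + k + 1)) hw k
  have hon : switchOn (fun t =>
      -C (m + k + 1) (deriv (hA.velocityCascade (fun k => C (m + k + 1)) w k) t)) =ᶠ[𝓝 (t + 1)]
      fun t => (-C (m + k + 1)) (deriv (hA.velocityCascade (fun k => C (m + k + 1)) w k) t) := by
    filter_upwards [Ioi_mem_nhds (show (1 / 2 : ℝ) < t + 1 by linarith)] with s hs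
    exact switchOn_eq_self (le_of_lt hs)
  rw [hon.iteratedDeriv_eq, iteratedDeriv_clm _ (contDiff_infty.1 (contDiff_deriv hV) _),
    ← iteratedDeriv_succ', cascade_add, show n - (m + k + 1) + 1 = n - (m + k) by omega]
  rfl

theorem isCascadeSol_cascade (hw : IsSmoothSol A (fun _ => 0) w) (hm : 1 ≤ m) (T : ℝ) :
    IsCascadeSol A C n T (hA.cascade C w m n) fun j => deriv (hA.cascade C w m n j) := by
  refine isCascadeSol_of_eq_zero hm (fun j hj => hA.cascade_of_lt hj) (fun j hj => ?_)
    ((hA.isSmoothSol_cascade_self hw).isSol hA T) fun j hmj hjn => ?_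
  · rw [hA.cascade_of_lt hj, deriv_const']
  · obtain ⟨k, rfl⟩ : ∃ k, j = m + k + 1 := ⟨j - m - 1, by omega⟩
    exact ((hA.isSmoothSol_cascade_succ hw.smooth k).isSol hA T).congr_source fun t ht =>
      hA.iteratedDeriv_switchOn_eq hw.smooth hjn ht.1

theorem energy_cascade (hw : IsSmoothSol A (fun _ => 0) w) (hmn : m ≤ n) :
    energy A (1 + (m : ℤ) - n) (hA.cascade C w m n m 0) (deriv (hA.cascade C w m n m) 0) =
      energy A 1 (w 0) (deriv w 0) := by
  rw [cascade_self, deriv_comp_add_const, ← iteratedDeriv_succ, hw.energy_eq hA 0 1,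
    ← IsSmoothSol.energy_iteratedDeriv hA hw (n - m) 1, Nat.cast_sub hmn, sub_sub_eq_add_sub]
  simp only [zero_add]

end A1

section

variable {G : Type*} [NormedAddCommGroup G] [InnerProductSpace 𝕜 G] {B : A.domain × H →ₗ[𝕜] G}
  [IsScalarTower ℝ 𝕜 H] {m : ℕ}

theorem A1.isObservation_cascade_last (hA : A1 A) (hB : A4 A B) {w : ℝ → H} {k : ℕ} {V f : ℝ → H}
    (hw : ContDiff ℝ ∞ w) (hV : hA.velocityCascade (fun k => C (m + k + 1)) w (k + 1) = V)
    (hsol : IsSmoothSol A f V) :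
    IsObservation A B T (fun t => -C (m + k + 1) (hA.cascade C w m (m + k + 1) (m + k) t))
      (hA.cascade C w m (m + k + 1) (m + k + 1))
      (deriv (hA.cascade C w m (m + k + 1) (m + k + 1)))
      (fun t => B (⟨V (t + 1), hsol.mem_domain (t + 1)⟩, deriv V (t + 1))) := by
  have hlast : hA.cascade C w m (m + k + 1) (m + k + 1) = fun t => V (t + 1) := by
    rw [add_assoc m k 1, hA.cascade_add (k + 1), Nat.sub_self, hV]
    rfl
  have hshift : deriv (fun t => V (t + 1)) = fun t => deriv V (t + 1) :=
    funext fun t => deriv_comp_add_const V 1 t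
  have hsource := ((hA.isSmoothSol_cascade_succ (C := C) (n := m + k + 1) hw k).isSol hA
    T).congr_source fun t ht => hA.iteratedDeriv_switchOn_eq hw le_rfl ht.1
  have hstrong := (hsol.comp_add_const 1).isStrongSol hA T
  rw [hlast, hshift] at hsource ⊢
  rw [hshift] at hstrong
  exact IsStrongSol.isObservation hB ⟨hsource, hstrong.2⟩

theorem OBS.exists_energy_le (hA : A1 A) (hB : A4 A B) {k : ℕ}
    (hm : 1 ≤ m) (hT : 0 < T) (h : OBS A C (m + k + 1) B T) :
    ∃ M, 0 < M ∧ ∀ w, IsSmoothSol A (fun _ => 0) w → energy A 1 (w 0) (deriv w 0) ≤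
      M * ∫ t in (0 : ℝ)..(T + 1), ‖C (m + 1) (deriv w t)‖ ^ 2 := by
  obtain ⟨c, hc, hobs⟩ := h
  obtain ⟨D, hD, hadm⟩ := hB.exists_integral_le hA hT zero_le_one
  obtain ⟨M, hM, hdrive⟩ := hA.exists_integral_velocityCascade_le (fun k => C (m + k + 1))
    (T := T + 1) (by linarith) k
  refine ⟨(D * M + 1) / c, by positivity, fun w hw => ?_⟩
  have hI : 0 ≤ ∫ t in (0 : ℝ)..(T + 1), ‖C (m + 1) (deriv w t)‖ ^ 2 :=
    intervalIntegral.integral_nonneg (by linarith) fun _ _ => sq_nonneg _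
  have hlast := hA.isSmoothSol_velocityCascade_succ (fun k => C (m + k + 1)) hw.smooth k
  have hlower := hobs _ _ _ (hA.isCascadeSol_cascade hw hm T)
    (hA.isObservation_cascade_last hB hw.smooth rfl hlast)
  have hupper := hadm _ _ hlast (hA.velocityCascade_succ_eq_zero _ hw.smooth k 0 le_rfl)
    (hA.deriv_velocityCascade_succ_eq_zero _ hw.smooth k 0 le_rfl)
  have hsource := (hA.integral_switchOn_velocityCascade_le (fun k => C (m + k + 1)) hw.smooth k
    (by linarith)).trans (hdrive w hw.smooth)
  have hfirst := energy_le_sum_energy (A := A) (n := m + k + 1) (Finset.mem_Icc.2 ⟨hm, by omega⟩)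
    (fun j => hA.cascade C w m (m + k + 1) j 0)
    (fun j => deriv (hA.cascade C w m (m + k + 1) j) 0)
  rw [hA.energy_cascade hw (by omega)] at hfirst
  rw [div_mul_eq_mul_div, le_div_iff₀ hc, mul_comm, add_mul, mul_assoc]
  refine (mul_le_mul_of_nonneg_left hfirst hc.le).trans (hlower.trans (hupper.trans ?_))
  exact (mul_le_mul_of_nonneg_left hsource hD.le).trans (by simpa using hI)

end

end Cascade

section Oscillator

variable {E : Type*} [NormedAddCommGroup E] [NormedSpace ℝ E]

theorem hasDerivWithinAt_integral_of_continuousOn [CompleteSpace E] {f : ℝ → E} {T t : ℝ}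
    (hf : ContinuousOn f (Icc 0 T)) (ht : t ∈ Icc 0 T) :
    HasDerivWithinAt (fun s => ∫ τ in (0 : ℝ)..s, f τ) (f t) (Icc 0 T) t := by
  have := Fact.mk ht
  exact intervalIntegral.integral_hasDerivWithinAt_right
    ((hf.mono (Icc_subset_Icc_right ht.2)).intervalIntegrable_of_Icc ht.1)
    (hf.stronglyMeasurableAtFilter_nhdsWithin measurableSet_Icc t) (hf t ht)

theorem eq_cos_smul_sub_sin_smul {r T t : ℝ} {p q : ℝ → E}
    (hp : ∀ s ∈ Icc 0 T, HasDerivWithinAt p (q s) (Icc 0 T) s)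
    (hq : ∀ s ∈ Icc 0 T, HasDerivWithinAt q (-(r ^ 2 • p s)) (Icc 0 T) s) (ht : t ∈ Icc 0 T) :
    q t = Real.cos (r * t) • q 0 - Real.sin (r * t) • r • p 0 := by
  have hderiv : ∀ s ∈ Icc 0 T, HasDerivWithinAt
      (fun s => Real.cos (r * (t - s)) • q s - Real.sin (r * (t - s)) • r • p s) 0 (Icc 0 T) s := by
    intro s hs
    have hangle : HasDerivWithinAt (fun s => r * (t - s)) (r * -1) (Icc 0 T) s :=
      ((hasDerivWithinAt_id s _).const_sub t).const_mul r
    refine ((hangle.cos.smul (hq s hs)).sub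
      (hangle.sin.smul ((hp s hs).fun_const_smul r))).congr_deriv ?_
    module
  have hconst := constant_of_derivWithin_zero (fun s hs => (hderiv s hs).differentiableWithinAt)
    (fun s hs => (hderiv s (Ico_subset_Icc_self hs)).derivWithin
      (uniqueDiffOn_Icc (hs.1.trans_lt hs.2) s (Ico_subset_Icc_self hs))) t ht
  simpa using hconst

theorem hasDerivAt_cos_smul_add_sin_smul {r : ℝ} (hr : r ≠ 0) (a b : E) (t : ℝ) :
    HasDerivAt (fun t => Real.cos (r * t) • a + (Real.sin (r * t) / r) • b)
      (Real.cos (r * t) • b - Real.sin (r * t) • r • a) t := by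
  have hangle : HasDerivAt (fun t => r * t) r t := by
    simpa using (hasDerivAt_id t).const_mul r
  refine ((hangle.cos.smul_const a).add ((hangle.sin.div_const r).smul_const b)).congr_deriv ?_
  rw [mul_div_cancel_right₀ _ hr]
  module

end Oscillator

section Density

theorem A1.eigenProj_fracPow_half (hA : A1 A) [NormedSpace ℝ H] [IsScalarTower ℝ 𝕜 H] {u : H}
    (hu : u ∈ powDom A (1 / 2)) (μ : ℝ) :
    eigenProj A μ (fracPow A (1 / 2) u) = √μ • eigenProj A μ u := by
  rw [hA.eigenProj_fracPow hu, Real.sqrt_eq_rpow, RCLike.real_smul_eq_coe_smul (K := 𝕜)]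

theorem IsSol.inner_velocity {T : ℝ} {w w' : ℝ → H}
    (h : IsSol A T (fun _ => 0) w w') {t r : ℝ} (ht : t ∈ Icc 0 T) {φ : H}
    (hφ : φ ∈ eigenspace A (r ^ 2)) :
    inner 𝕜 φ (w' t) = Real.cos (r * t) • inner 𝕜 φ (w' 0) -
      Real.sin (r * t) • r • inner 𝕜 φ (w 0) := by
  obtain ⟨x, rfl, hx⟩ := hφ
  have hq : ContinuousOn (fun s => inner 𝕜 (x : H) (w' s)) (Icc 0 T) :=
    continuousOn_const.inner h.cont'
  have hp' : ∀ s ∈ Icc 0 T,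
      HasDerivWithinAt (fun s => inner 𝕜 (x : H) (w s)) (inner 𝕜 (x : H) (w' s)) (Icc 0 T) s :=
    fun s hs => ((hasDerivWithinAt_integral_of_continuousOn hq hs).const_add _).congr_of_mem
      (fun τ hτ => h.deriv x τ hτ) hs
  have hp : ContinuousOn (fun s => inner 𝕜 (x : H) (w s)) (Icc 0 T) :=
    fun s hs => (hp' s hs).continuousWithinAt
  refine eq_cos_smul_sub_sin_smul hp' (fun s hs => ?_) ht
  have hequation : ∀ τ ∈ Icc 0 T, inner 𝕜 (x : H) (w' τ) =
      inner 𝕜 (x : H) (w' 0) - ∫ σ in (0 : ℝ)..τ, r ^ 2 • inner 𝕜 (x : H) (w σ) := by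
    intro τ hτ
    have heq := h.equation x τ hτ
    simp only [hx, inner_smul_left, RCLike.conj_ofReal, inner_zero_right,
      intervalIntegral.integral_zero, add_zero] at heq
    simpa only [RCLike.real_smul_eq_coe_mul] using heq
  exact ((hasDerivWithinAt_integral_of_continuousOn (hp.const_smul (r ^ 2)) hs).const_sub
    _).congr_of_mem hequation hs

theorem IsSol.eigenProj_velocity (hA : A1 A) [NormedSpace ℝ H] [IsScalarTower ℝ 𝕜 H] {T : ℝ}
    {w w' : ℝ → H} (h : IsSol A T (fun _ => 0) w w') {t : ℝ} (ht : t ∈ Icc 0 T) (μ : ℝ) :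
    eigenProj A μ (w' t) = Real.cos (√μ * t) • eigenProj A μ (w' 0) -
      Real.sin (√μ * t) • √μ • eigenProj A μ (w 0) := by
  rcases le_or_gt μ 0 with hμ | hμ
  · simp only [hA.eigenProj_eq_zero_of_nonpos hμ, smul_zero, sub_zero]
  refine ext_inner_left 𝕜 fun φ => ?_
  have hφ : eigenProj A μ φ ∈ eigenspace A (√μ ^ 2) := by
    rw [Real.sq_sqrt hμ.le]
    exact hA.eigenProj_mem μ φ
  simpa only [inner_sub_right, RCLike.real_smul_eq_coe_smul (K := 𝕜), inner_smul_right,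
    inner_eigenProj_left, smul_eq_mul] using h.inner_velocity ht hφ

/-- The orthogonal projection onto the sum of the eigenspaces of `A` for `μ ∈ F`, which truncates
the spectral expansion of a vector. -/
def spectralSum (A : H →ₗ.[𝕜] H) (F : Finset ℝ) : H →L[𝕜] H := ∑ μ ∈ F, eigenProj A μ

theorem spectralSum_apply (F : Finset ℝ) (x : H) :
    spectralSum A F x = ∑ μ ∈ F, eigenProj A μ x :=
  sum_apply _ _ _

namespace A1

variable (hA : A1 A)
include hA

theorem tendsto_spectralSum (x : H) : Tendsto (fun F => spectralSum A F x) atTop (𝓝 x) := by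
  simpa only [spectralSum_apply, HasSum, SummationFilter.unconditional_filter] using
    hA.hasSum_eigenProj x

theorem eigenProj_spectralSum (F : Finset ℝ) (μ : ℝ) (x : H) :
    eigenProj A μ (spectralSum A F x) = if μ ∈ F then eigenProj A μ x else 0 := by
  have hcomp (ν) : eigenProj A μ (eigenProj A ν x) = if μ = ν then eigenProj A μ x else 0 := by
    split_ifs with h
    · rw [← h, hA.eigenProj_eigenProj]
    · exact hA.eigenProj_of_mem_ne h (hA.eigenProj_mem ν x)
  rw [spectralSum_apply, map_sum]
  simp only [hcomp, Finset.sum_ite_eq]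

theorem fracPow_spectralSum {s : ℝ} {u : H} (hu : u ∈ powDom A s) (F : Finset ℝ) :
    fracPow A s (spectralSum A F u) = spectralSum A F (fracPow A s u) := by
  refine (hA.fracPow_eq fun μ _ => ?_).2
  simp only [hA.eigenProj_spectralSum, hA.eigenProj_fracPow hu, smul_ite, smul_zero]

theorem norm_sq_le_of_eigenProj_le_add {x a b : H}
    (h : ∀ μ, ‖eigenProj A μ x‖ ≤ ‖eigenProj A μ a‖ + ‖eigenProj A μ b‖) :
    ‖x‖ ^ 2 ≤ 2 * (‖a‖ ^ 2 + ‖b‖ ^ 2) :=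
  hasSum_le (fun μ => (pow_le_pow_left₀ (norm_nonneg _) (h μ) 2).trans add_sq_le)
    (hA.hasSum_norm_eigenProj_sq x)
    (((hA.hasSum_norm_eigenProj_sq a).add (hA.hasSum_norm_eigenProj_sq b)).mul_left 2)

end A1

variable [NormedSpace ℝ H] [IsScalarTower ℝ 𝕜 H]

omit [CompleteSpace H] in
theorem isSmoothSol_of_mem_eigenspace {μ : ℝ} {z : ℝ → H} (hz : ContDiff ℝ ∞ z)
    (hmem : ∀ t, z t ∈ eigenspace A μ) (h : ∀ t, deriv (deriv z) t = -(μ • z t)) :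
    IsSmoothSol A (fun _ => 0) z where
  source := contDiff_const
  smooth := hz
  mem_domain t := by
    obtain ⟨x, hx, -⟩ := hmem t
    exact hx ▸ x.2
  equation t := by
    obtain ⟨x, hx, hAx⟩ := hmem t
    refine (congrArg A (Subtype.ext hx.symm)).trans (hAx.trans ?_)
    rw [h, zero_sub, neg_neg, RCLike.real_smul_eq_coe_smul (K := 𝕜)]

theorem A1.exists_isSmoothSol_eigenProj (hA : A1 A) (μ : ℝ) (u v : H) :
    ∃ z, IsSmoothSol A (fun _ => 0) z ∧ z 0 = eigenProj A μ u ∧ ∀ t, deriv z t =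
      Real.cos (√μ * t) • eigenProj A μ v - Real.sin (√μ * t) • √μ • eigenProj A μ u := by
  rcases le_or_gt μ 0 with hμ | hμ
  · refine ⟨_, IsSmoothSol.zero, ?_⟩
    simp [hA.eigenProj_eq_zero_of_nonpos hμ]
  have hr : √μ ≠ 0 := (Real.sqrt_pos.2 hμ).ne'
  have hsqrt (s : ℝ) : s / √μ * μ = s * √μ := by
    rw [div_mul_eq_mul_div, mul_div_assoc, Real.div_sqrt]
  set a := eigenProj A μ u
  set b := eigenProj A μ v
  have hz' := hasDerivAt_cos_smul_add_sin_smul hr a b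
  refine ⟨_, isSmoothSol_of_mem_eigenspace (μ := μ) ?_ (fun t => ?_) fun t => ?_, ?_,
    fun t => (hz' t).deriv⟩
  · fun_prop
  · simp only [RCLike.real_smul_eq_coe_smul (K := 𝕜)]
    exact add_mem (Submodule.smul_mem _ _ (hA.eigenProj_mem μ u))
      (Submodule.smul_mem _ _ (hA.eigenProj_mem μ v))
  · have hvelocity : deriv (fun t => Real.cos (√μ * t) • a + (Real.sin (√μ * t) / √μ) • b) =
        fun t => Real.cos (√μ * t) • b + (Real.sin (√μ * t) / √μ) • -(μ • a) := by
      refine funext fun s => (hz' s).deriv.trans ?_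
      rw [smul_neg, smul_smul, smul_smul, hsqrt, sub_eq_add_neg]
    rw [hvelocity, (hasDerivAt_cos_smul_add_sin_smul hr b (-(μ • a)) t).deriv, smul_add, smul_smul,
      smul_smul, smul_neg, smul_smul, smul_smul, mul_comm μ (_ / _), hsqrt, mul_comm μ]
    abel
  · simp

theorem A1.exists_isSmoothSol_spectralSum (hA : A1 A) {T : ℝ} {w w' : ℝ → H}
    (h : IsSol A T (fun _ => 0) w w') (F : Finset ℝ) :
    ∃ z, IsSmoothSol A (fun _ => 0) z ∧ z 0 = spectralSum A F (w 0) ∧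
      ∀ t ∈ Icc 0 T, deriv z t = spectralSum A F (w' t) := by
  choose z hz hz0 hz' using fun μ => hA.exists_isSmoothSol_eigenProj μ (w 0) (w' 0)
  refine ⟨_, IsSmoothSol.sum fun μ (_ : μ ∈ F) => hz μ, ?_, fun t ht => ?_⟩
  · simp only [hz0, spectralSum_apply]
  · rw [(HasDerivAt.fun_sum fun μ _ => hasDerivAt_of_contDiff (hz μ).smooth t).deriv,
      spectralSum_apply]
    exact Finset.sum_congr rfl fun μ _ => by rw [hz', h.eigenProj_velocity hA ht]

theorem IsSol.norm_velocity_sub_spectralSum_sq_le (hA : A1 A) {T : ℝ} {w w' : ℝ → H}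
    (h : IsSol A T (fun _ => 0) w w') {t : ℝ} (ht : t ∈ Icc 0 T) (F : Finset ℝ) :
    ‖w' t - spectralSum A F (w' t)‖ ^ 2 ≤ 2 * (‖w' 0 - spectralSum A F (w' 0)‖ ^ 2 +
      ‖fracPow A (1 / 2) (w 0) - spectralSum A F (fracPow A (1 / 2) (w 0))‖ ^ 2) := by
  refine hA.norm_sq_le_of_eigenProj_le_add fun μ => ?_
  simp only [map_sub, hA.eigenProj_spectralSum]
  split_ifs
  · simp only [sub_self, norm_zero, add_zero, le_refl]
  · rw [sub_zero, sub_zero, sub_zero, h.eigenProj_velocity hA ht,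
      hA.eigenProj_fracPow_half (h.mem 0 ⟨le_rfl, ht.1.trans ht.2⟩)]
    refine (norm_sub_le _ _).trans (add_le_add ?_ ?_) <;> rw [norm_smul]
    · exact mul_le_of_le_one_left (norm_nonneg _) (Real.abs_cos_le_one _)
    · exact mul_le_of_le_one_left (norm_nonneg _) (Real.abs_sin_le_one _)

theorem integral_norm_sq_le_of_norm_sub_sq_le {E F : Type*} [NormedAddCommGroup E]
    [NormedAddCommGroup F] [NormedSpace 𝕜 E] [NormedSpace 𝕜 F] (L : E →L[𝕜] F) {T δ : ℝ}
    (hT : 0 ≤ T) {f g : ℝ → E} (hf : ContinuousOn f (Icc 0 T)) (hg : ContinuousOn g (Icc 0 T))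
    (hfg : ∀ t ∈ Icc 0 T, ‖f t - g t‖ ^ 2 ≤ δ) :
    ∫ t in (0 : ℝ)..T, ‖L (g t)‖ ^ 2 ≤
      2 * (∫ t in (0 : ℝ)..T, ‖L (f t)‖ ^ 2) + T * (2 * (‖L‖ ^ 2 * δ)) := by
  have hint {h : ℝ → E} (hh : ContinuousOn h (Icc 0 T)) :
      IntervalIntegrable (fun t => ‖L (h t)‖ ^ 2) volume 0 T :=
    ((L.continuous.comp_continuousOn hh).norm.pow 2).intervalIntegrable_of_Icc hT
  have hpointwise : ∀ t ∈ Icc 0 T, ‖L (g t)‖ ^ 2 ≤ 2 * ‖L (f t)‖ ^ 2 + 2 * (‖L‖ ^ 2 * δ) := by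
    intro t ht
    calc ‖L (g t)‖ ^ 2 ≤ (‖L (f t)‖ + ‖L (f t - g t)‖) ^ 2 := by
          rw [map_sub]
          gcongr
          exact norm_le_norm_add_norm_sub _ _
      _ ≤ 2 * (‖L (f t)‖ ^ 2 + ‖L (f t - g t)‖ ^ 2) := add_sq_le
      _ ≤ 2 * (‖L (f t)‖ ^ 2 + ‖L‖ ^ 2 * δ) := by
          have hL : ‖L (f t - g t)‖ ^ 2 ≤ (‖L‖ * ‖f t - g t‖) ^ 2 := by
            gcongr
            exact L.le_opNorm _
          rw [mul_pow] at hL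
          have := hL.trans (mul_le_mul_of_nonneg_left (hfg t ht) (sq_nonneg _))
          gcongr
      _ = _ := mul_add _ _ _
  refine (intervalIntegral.integral_mono_on hT (hint hg)
    (((hint hf).const_mul 2).add intervalIntegrable_const) hpointwise).trans_eq ?_
  rw [intervalIntegral.integral_add ((hint hf).const_mul 2) intervalIntegrable_const,
    intervalIntegral.integral_const_mul, intervalIntegral.integral_const, smul_eq_mul, sub_zero]

theorem A1.energy_le_of_isSmoothSol (hA : A1 A) {T M : ℝ} (hT : 0 ≤ T) (hM : 0 ≤ M)
    (L : H →L[𝕜] H)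
    (hL : ∀ z, IsSmoothSol A (fun _ => 0) z →
      energy A 1 (z 0) (deriv z 0) ≤ M * ∫ t in (0 : ℝ)..T, ‖L (deriv z t)‖ ^ 2)
    {w w' : ℝ → H} (h : IsSol A T (fun _ => 0) w w') :
    energy A 1 (w 0) (w' 0) ≤ M * (2 * ∫ t in (0 : ℝ)..T, ‖L (w' t)‖ ^ 2) := by
  have h0 : (0 : ℝ) ∈ Icc 0 T := ⟨le_rfl, hT⟩
  set y := fracPow A (1 / 2) (w 0) with hy
  set I := ∫ t in (0 : ℝ)..T, ‖L (w' t)‖ ^ 2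
  let tail (F : Finset ℝ) := 2 * (‖w' 0 - spectralSum A F (w' 0)‖ ^ 2 + ‖y - spectralSum A F y‖ ^ 2)
  have htail : Tendsto tail atTop (𝓝 0) := by
    have hlim (x : H) : Tendsto (fun F => ‖x - spectralSum A F x‖ ^ 2) atTop (𝓝 0) := by
      simpa using ((tendsto_const_nhds (x := x)).sub (hA.tendsto_spectralSum x)).norm.pow 2
    simpa using ((hlim (w' 0)).add (hlim y)).const_mul 2
  have htruncated : ∀ F, (‖spectralSum A F y‖ ^ 2 + ‖spectralSum A F (w' 0)‖ ^ 2) / 2 ≤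
      M * (2 * I + T * (2 * (‖L‖ ^ 2 * tail F))) := by
    intro F
    obtain ⟨z, hz, hz0, hz'⟩ := hA.exists_isSmoothSol_spectralSum h F
    have henergy := hL z hz
    rw [hz0, hz' 0 h0, hA.energy_one, hA.fracPow_spectralSum (h.mem 0 h0), ← hy] at henergy
    refine henergy.trans (mul_le_mul_of_nonneg_left ?_ hM)
    refine integral_norm_sq_le_of_norm_sub_sq_le L hT h.cont'
      (contDiff_deriv hz.smooth).continuous.continuousOn fun t ht => ?_
    rw [hz' t ht]
    exact h.norm_velocity_sub_spectralSum_sq_le hA ht F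
  rw [hA.energy_one]
  refine le_of_tendsto_of_tendsto' ((((hA.tendsto_spectralSum y).norm.pow 2).add
    ((hA.tendsto_spectralSum (w' 0)).norm.pow 2)).div_const 2) ?_ htruncated
  simpa using
    ((((htail.const_mul (‖L‖ ^ 2)).const_mul 2).const_mul T).const_add (2 * I)).const_mul M

end Density

section Necessity

variable {G : Type*} [NormedAddCommGroup G] [InnerProductSpace 𝕜 G] {B : A.domain × H →ₗ[𝕜] G}
  {C : ℕ → H →L[𝕜] H} {n : ℕ}

theorem OBS.exists_le_integral_observation (hn : 1 ≤ n) {T : ℝ} (h : OBS A C n B T) :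
    ∃ R, 0 < R ∧ ∀ (w w' : ℝ → H) (y : ℝ → G), IsSol A T (fun _ => 0) w w' →
      IsObservation A B T (fun _ => 0) w w' y →
      R * energy A 1 (w 0) (w' 0) ≤ ∫ t in (0 : ℝ)..T, ‖y t‖ ^ 2 := by
  obtain ⟨c, hc, hobs⟩ := h
  refine ⟨c, hc, fun w w' y hw hy => ?_⟩
  let last (z : ℝ → H) : ℕ → ℝ → H := fun j => if j = n then z else fun _ => 0
  have last_self (z) : last z n = z := if_pos rfl
  have last_of_lt (z) : ∀ j < n, last z j = fun _ => 0 := fun j hj => if_neg hj.ne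
  have hcascade : IsCascadeSol A C n T (last w) (last w') := by
    refine isCascadeSol_of_eq_zero hn (last_of_lt w) (last_of_lt w') ?_ fun j hj hjn => by omega
    rwa [last_self, last_self]
  have hle := hobs _ _ y hcascade (by
    rw [last_of_lt w (n - 1) (by omega)]
    simpa only [last_self, map_zero, neg_zero] using hy)
  have hfirst := energy_le_sum_energy (A := A) (Finset.mem_Icc.2 ⟨hn, le_rfl⟩)
    (fun j => last w j 0) (fun j => last w' j 0)
  simp only [last_self, add_sub_cancel_right] at hfirst
  exact (mul_le_mul_of_nonneg_left hfirst hc.le).trans hle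

theorem OBS.exists_le_integral_coupling (hA : A1 A) (hB : A4 A B) {T : ℝ} (hT : 0 < T)
    (h : OBS A C n B T) {i : ℕ} (hi : i ∈ Finset.Icc 2 n) :
    ∃ γ, 0 < γ ∧ ∀ w w' : ℝ → H, IsSol A (T + 1) (fun _ => 0) w w' →
      γ * energy A 1 (w 0) (w' 0) ≤ ∫ t in (0 : ℝ)..(T + 1), ‖C i (w' t)‖ ^ 2 := by
  let : NormedSpace ℝ H := NormedSpace.restrictScalars ℝ 𝕜 H
  have : IsScalarTower ℝ 𝕜 H := IsScalarTower.of_algebraMap_smul fun _ _ => rfl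
  obtain ⟨m, rfl⟩ : ∃ m, i = m + 1 := ⟨i - 1, by have := Finset.mem_Icc.1 hi; omega⟩
  obtain ⟨k, rfl⟩ : ∃ k, n = m + k + 1 := ⟨n - m - 1, by have := Finset.mem_Icc.1 hi; omega⟩
  have hm : 1 ≤ m := by have := Finset.mem_Icc.1 hi; omega
  obtain ⟨M, hM, hsmooth⟩ := h.exists_energy_le hA hB hm hT
  refine ⟨(M * 2)⁻¹, by positivity, fun w w' hw => ?_⟩
  rw [inv_mul_le_iff₀ (by positivity), mul_assoc]
  exact hA.energy_le_of_isSmoothSol (by linarith) hM.le (C (m + 1)) hsmooth hw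

end Necessity

end Cascade

end

theorem theorem2p6_general {𝕜 : Type*} [RCLike 𝕜]
    {H : Type*} [NormedAddCommGroup H] [InnerProductSpace 𝕜 H] [CompleteSpace H]
    {G : Type*} [NormedAddCommGroup G] [InnerProductSpace 𝕜 G]
    {A : H →ₗ.[𝕜] H} {n : ℕ} (hn : 1 ≤ n) {C : ℕ → H →L[𝕜] H} {B : A.domain × H →ₗ[𝕜] G}
    (hA : Cascade.A1 A) (hB : Cascade.A4 A B)
    (h : ∃ Tstar : ℝ, 0 < Tstar ∧ ∀ T : ℝ, Tstar < T → Cascade.OBS A C n B T) :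
    Cascade.A5 A B ∧ Cascade.A3 A C n := by
  obtain ⟨Tstar, hpos, hobs⟩ := h
  refine ⟨⟨Tstar, hpos, fun T hT => (hobs T hT).exists_le_integral_observation hn⟩,
    fun i hi => ⟨Tstar + 1, by linarith, fun T hT => ?_⟩⟩
  simpa only [sub_add_cancel] using
    (hobs (T - 1) (by linarith)).exists_le_integral_coupling hA hB (by linarith) hi

theorem theorem2p6 {𝕜 : Type*} [RCLike 𝕜]
    {H : Type*} [NormedAddCommGroup H] [InnerProductSpace 𝕜 H] [CompleteSpace H]
    {G : Type*} [NormedAddCommGroup G] [InnerProductSpace 𝕜 G] [CompleteSpace G]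
    (A : H →ₗ.[𝕜] H) (n : ℕ) (hn : 2 ≤ n) (C : ℕ → H →L[𝕜] H) (B : A.domain × H →ₗ[𝕜] G)
    (hA1 : Cascade.A1 A) (hA2 : Cascade.A2 A C C n) (hA4 : Cascade.A4 A B)
    (hfail : ¬ Cascade.A5 A B ∨ ¬ Cascade.A3 A C n) :
    ¬ ∃ Tstar : ℝ, 0 < Tstar ∧ ∀ T : ℝ, Tstar < T → Cascade.OBS A C n B T := fun h =>
  have ⟨hA5, hA3⟩ := theorem2p6_general (one_le_two.trans hn) hA1 hA4 h
  hfail.elim (· hA5) (· hA3)
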